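/- Let $\Omega\subset\mathbb R^N$ be a non-empty open set and $1<p<\infty$, $1/p+1/p'=1$. Equip $W^{1,p}(\Omega)$ with the norm $\|u\|_{W^{1,p}(\Omega)}^p=\|u\|_{L^p(\Omega)}^p+\sum_{i=1}^N\|D_iu\|_{L^p(\Omega)}^p$, and let $\tilde W^{1,p}(\Omega)$ be the closure in $W^{1,p}(\Omega)$ of the set $W^{1,p}(\Omega)\cap C_c(\overline\Omega)$ of those $v|_\Omega\in W^{1,p}(\Omega)$ with $v\in C_c(\overline\Omega)$. For $A\subset\overline\Omega$ let $$\mathrm{Cap}_{p,\Omega}(A)=\inf\{\|u\|_{W^{1,p}(\Omega)}^p : u\in\tilde W^{1,p}(\Omega),\ u\ge 1 \text{ a.e. on } O\cap\Omega \text{ for some } O\supset A \text{ open in } \overline\Omega\}\in[0,\infty].$$ A set $P\subset\overline\Omega$ is $\mathrm{Cap}_{p,\Omega}$-polar if $\mathrm{Cap}_{p,\Omega}(P)=0$; a function $f:\overline\Omega\to\mathbb R$ is $\mathrm{Cap}_{p,\Omega}$-quasi continuous if for every $\varepsilon>0$ there is a set $V$, open in $\overline\Omega$, with $\mathrm{Cap}_{p,\Omega}(V)<\varepsilon$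 such that $f|_{\overline\Omega\setminus V}$ is continuous. The refined Sobolev space $\mathcal W^{1,p}(\Omega)$ consists of the classes $\tilde u$, $u\in\tilde W^{1,p}(\Omega)$, where $\tilde u$ is the class, modulo equality outside a polar set, of the quasi continuous functions on $\overline\Omega$ that equal $u$ a.e. on $\Omega$; it carries the norm and the linear structure of $\tilde W^{1,p}(\Omega)$. Let $\mu$ be a Radon measure on $\overline\Omega$ (a locally finite, inner regular Borel measure) which belongs to $\mathcal W^{1,p}(\Omega)'$, that is, $$\sup\Big\{\int_{\overline\Omega} v\,d\mu : v\in\mathcal W^{1,p}(\Omega)\cap C_c(\overline\Omega),\ \|v\|_{W^{1,p}(\Omega)}\le 1\Big\}<\infty ,$$ and let $E(\mu)=\|\mu\|_{\mathcal W^{1,p}(\Omega)'}^{p'}$ be its energy, where $\|\mu\|_{\mathcal W^{1,p}(\Omega)'}$ is the norm of the unique continuous linear extension of $v\mapsto\int v\,d\mu$ from $\mathcal W^{1,p}(\Omega)\cap C_c(\overline\Omega)$ to $\mathcal W^{1,p}(\Omega)$. Then for every $\mu$-measurable set $A\subset\overline\Omega$ $$\mu(A)^p\le E(\mu)^{p-1}\,\mathrm{Cap}_{p,\Omega}(A)$$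 (with $0\cdot\infty=0$). Consequently $\mu(P)=0$ for every $\mathrm{Cap}_{p,\Omega}$-polar set $P\subset\overline\Omega$. -/

import Mathlib

open MeasureTheory TopologicalSpace
open scoped ENNReal NNReal Distributions CompactlySupported

noncomputable section

namespace RelCap

/-- The Euclidean space `ℝ^N`. -/
abbrev Euc (N : ℕ) : Type := EuclideanSpace ℝ (Fin N)

variable {N : ℕ}

/-- The closure `Ω̄` of an open set `Ω ⊆ ℝ^N`, as a topological (and Borel) space. -/
abbrev Clos (Ω : Opens (Euc N)) : Type := closure (Ω : Set (Euc N))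

/-- `g` is the weak (distributional) derivative of `u` on `Ω` in the `i`-th coordinate direction. -/
def IsWeakDeriv (Ω : Opens (Euc N)) (i : Fin N) (u g : Euc N → ℝ) : Prop :=
  ∀ φ : 𝓓(Ω, ℝ),
    ∫ x in Ω, u x * fderiv ℝ φ x (EuclideanSpace.single i 1) = -∫ x in Ω, g x * φ x

/-- `L^p(Ω)^{N+1}` with the norm `‖U‖^p = ∑ ‖U_j‖_{L^p(Ω)}^p`; the index `none` is for the function
and the indices `some i` are for its partial derivatives. -/
abbrev LpTuple (Ω : Opens (Euc N)) (p : ℝ≥0) [Fact (1 ≤ (p : ℝ≥0∞))] : Type :=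
  PiLp (p : ℝ≥0∞)
    (fun _ : Option (Fin N) => Lp ℝ (p : ℝ≥0∞) (volume.restrict (Ω : Set (Euc N))))

theorem integrable_mul_test {Ω : Opens (Euc N)} {p : ℝ≥0} [hp : Fact (1 ≤ (p : ℝ≥0∞))]
    (u : Lp ℝ (p : ℝ≥0∞) (volume.restrict (Ω : Set (Euc N)))) {ψ : Euc N → ℝ}
    (hψ : Continuous ψ) (hc : HasCompactSupport ψ) :
    Integrable (fun x => u x * ψ x) (volume.restrict (Ω : Set (Euc N))) :=
  ((Lp.memLp u).locallyIntegrable hp.out).integrable_smul_right_of_hasCompactSupport hψ hc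

theorem continuous_partial {Ω : Opens (Euc N)} (φ : 𝓓(Ω, ℝ)) (v : Euc N) :
    Continuous (fun x => fderiv ℝ φ x v) :=
  (φ.contDiff.continuous_fderiv (by simp)).clm_apply continuous_const

theorem hasCompactSupport_partial {Ω : Opens (Euc N)} (φ : 𝓓(Ω, ℝ)) (v : Euc N) :
    HasCompactSupport (fun x => fderiv ℝ φ x v) :=
  φ.hasCompactSupport.fderiv_apply (𝕜 := ℝ) v

/-- The Sobolev space `W^{1,p}(Ω)`. A Sobolev function is recorded together with its weak partial
derivatives (which it determines almost everywhere), so that the norm is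
`‖u‖^p = ‖u‖_{L^p}^p + ∑ i, ‖D_i u‖_{L^p}^p`. -/
def sobolevGraph (Ω : Opens (Euc N)) (p : ℝ≥0) [Fact (1 ≤ (p : ℝ≥0∞))] :
    Submodule ℝ (LpTuple Ω p) where
  carrier := {U | ∀ i, IsWeakDeriv Ω i (U none) (U (some i))}
  zero_mem' := by
    intro i φ
    have h := Lp.coeFn_zero ℝ (p : ℝ≥0∞) (volume.restrict (Ω : Set (Euc N)))
    have e1 : ∫ x in Ω, (0 : LpTuple Ω p) none x * fderiv ℝ φ x (EuclideanSpace.single i 1)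
        = 0 := by
      apply integral_eq_zero_of_ae
      filter_upwards [h] with x hx
      rw [PiLp.zero_apply, hx]
      simp
    have e2 : ∫ x in Ω, (0 : LpTuple Ω p) (some i) x * φ x = 0 := by
      apply integral_eq_zero_of_ae
      filter_upwards [h] with x hx
      rw [PiLp.zero_apply, hx]
      simp
    rw [e1, e2, neg_zero]
  add_mem' := by
    intro U V hU hV i φ
    have key : ∀ (j : Option (Fin N)) (ψ : Euc N → ℝ), Continuous ψ → HasCompactSupport ψ →
        ∫ x in Ω, (U + V) j x * ψ x = (∫ x in Ω, U j x * ψ x) + ∫ x in Ω, V j x * ψ x := by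
      intro j ψ hψ hc
      rw [← integral_add (integrable_mul_test _ hψ hc) (integrable_mul_test _ hψ hc)]
      apply integral_congr_ae
      filter_upwards [Lp.coeFn_add (U j) (V j)] with x hx
      rw [PiLp.add_apply, hx, Pi.add_apply, add_mul]
    rw [key _ _ (continuous_partial φ _) (hasCompactSupport_partial φ _),
      key _ _ φ.contDiff.continuous φ.hasCompactSupport, hU i φ, hV i φ]
    ring
  smul_mem' := by
    intro c U hU i φ
    have key : ∀ (j : Option (Fin N)) (ψ : Euc N → ℝ),
        ∫ x in Ω, (c • U) j x * ψ x = c * ∫ x in Ω, U j x * ψ x := by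
      intro j ψ
      rw [← integral_const_mul]
      apply integral_congr_ae
      filter_upwards [Lp.coeFn_smul c (U j)] with x hx
      rw [PiLp.smul_apply, hx, Pi.smul_apply, smul_eq_mul, mul_assoc]
    rw [key, key, hU i φ]
    ring

/-- `W^{1,p}(Ω)` as a normed space. -/
def Sobolev (Ω : Opens (Euc N)) (p : ℝ≥0) [Fact (1 ≤ (p : ℝ≥0∞))] : Type :=
  sobolevGraph Ω p

instance (Ω : Opens (Euc N)) (p : ℝ≥0) [Fact (1 ≤ (p : ℝ≥0∞))] :
    NormedAddCommGroup (Sobolev Ω p) :=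
  inferInstanceAs (NormedAddCommGroup (sobolevGraph Ω p))

instance (Ω : Opens (Euc N)) (p : ℝ≥0) [Fact (1 ≤ (p : ℝ≥0∞))] :
    NormedSpace ℝ (Sobolev Ω p) :=
  inferInstanceAs (NormedSpace ℝ (sobolevGraph Ω p))

variable {Ω : Opens (Euc N)} {p : ℝ≥0} [Fact (1 ≤ (p : ℝ≥0∞))]

/-- The Sobolev function `u` together with its weak partial derivatives. -/
def Sobolev.tuple (u : Sobolev Ω p) : LpTuple Ω p := Subtype.val (p := (· ∈ sobolevGraph Ω p)) u

/-- The function (up to almost everywhere equality on `Ω`) underlying a Sobolev function. -/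
def fn (u : Sobolev Ω p) : Euc N → ℝ := u.tuple none

theorem fn_add (u v : Sobolev Ω p) :
    fn (u + v) =ᵐ[volume.restrict (Ω : Set (Euc N))] fn u + fn v :=
  Lp.coeFn_add (u.tuple none) (v.tuple none)

theorem fn_smul (c : ℝ) (u : Sobolev Ω p) :
    fn (c • u) =ᵐ[volume.restrict (Ω : Set (Euc N))] c • fn u :=
  Lp.coeFn_smul c (u.tuple none)

theorem fn_zero : fn (0 : Sobolev Ω p) =ᵐ[volume.restrict (Ω : Set (Euc N))] 0 :=
  Lp.coeFn_zero ℝ (p : ℝ≥0∞) (volume.restrict (Ω : Set (Euc N)))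

/-- `f : Ω̄ → ℝ` equals the Sobolev function `u` almost everywhere on `Ω`. -/
def IsVersion (f : Clos Ω → ℝ) (u : Sobolev Ω p) : Prop :=
  ∀ᵐ x ∂(volume.restrict (Ω : Set (Euc N))),
    ∀ hx : x ∈ closure (Ω : Set (Euc N)), f ⟨x, hx⟩ = fn u x

theorem IsVersion.add {f g : Clos Ω → ℝ} {u v : Sobolev Ω p} (hf : IsVersion f u)
    (hg : IsVersion g v) : IsVersion (f + g) (u + v) := by
  filter_upwards [hf, hg, fn_add u v] with x h1 h2 h3 hx
  rw [h3, Pi.add_apply, Pi.add_apply, h1 hx, h2 hx]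

theorem IsVersion.smul {f : Clos Ω → ℝ} {u : Sobolev Ω p} (c : ℝ) (hf : IsVersion f u) :
    IsVersion (c • f) (c • u) := by
  filter_upwards [hf, fn_smul c u] with x h1 h3 hx
  rw [h3, Pi.smul_apply, Pi.smul_apply, h1 hx]

theorem isVersion_zero : IsVersion (0 : Clos Ω → ℝ) (0 : Sobolev Ω p) := by
  filter_upwards [fn_zero (Ω := Ω) (p := p)] with x h hx
  rw [h]; rfl

/-- `W^{1,p}(Ω) ∩ C_c(Ω̄)`, as a subspace of `W^{1,p}(Ω)`. -/
def sobolevCc (Ω : Opens (Euc N)) (p : ℝ≥0) [Fact (1 ≤ (p : ℝ≥0∞))] :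
    Submodule ℝ (Sobolev Ω p) where
  carrier := {u | ∃ v : C_c(Clos Ω, ℝ), IsVersion v u}
  zero_mem' := ⟨0, isVersion_zero⟩
  add_mem' := by
    rintro u u' ⟨v, hv⟩ ⟨v', hv'⟩
    exact ⟨v + v', hv.add hv'⟩
  smul_mem' := by
    rintro c u ⟨v, hv⟩
    exact ⟨c • v, hv.smul c⟩

/-- `W̃^{1,p}(Ω)`, the closure of `W^{1,p}(Ω) ∩ C_c(Ω̄)` in `W^{1,p}(Ω)`. -/
def sobolevTilde (Ω : Opens (Euc N)) (p : ℝ≥0) [Fact (1 ≤ (p : ℝ≥0∞))] :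
    Submodule ℝ (Sobolev Ω p) :=
  (sobolevCc Ω p).topologicalClosure

/-- The admissible functions for the relative capacity of `A ⊆ Ω̄`: those `u ∈ W̃^{1,p}(Ω)` with
`u ≥ 1` almost everywhere on `O ∩ Ω` for some `O ⊇ A` that is open in `Ω̄`. -/
def admissible (Ω : Opens (Euc N)) (p : ℝ≥0) [Fact (1 ≤ (p : ℝ≥0∞))] (A : Set (Clos Ω)) :
    Set (Sobolev Ω p) :=
  {u | u ∈ sobolevTilde Ω p ∧ ∃ O : Set (Clos Ω), IsOpen O ∧ A ⊆ O ∧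
    ∀ᵐ x ∂(volume.restrict (Ω : Set (Euc N))),
      ∀ hx : x ∈ closure (Ω : Set (Euc N)), (⟨x, hx⟩ : Clos Ω) ∈ O → 1 ≤ fn u x}

/-- The relative `p`-capacity of `A ⊆ Ω̄`. It is `∞` if there is no admissible function. -/
def relCap (Ω : Opens (Euc N)) (p : ℝ≥0) [Fact (1 ≤ (p : ℝ≥0∞))] (A : Set (Clos Ω)) : ℝ≥0∞ :=
  ⨅ u ∈ admissible Ω p A, ‖u‖ₑ ^ (p : ℝ)

/-- Sets of relative `p`-capacity zero. -/
def IsPolar (Ω : Opens (Euc N)) (p : ℝ≥0) [Fact (1 ≤ (p : ℝ≥0∞))] (A : Set (Clos Ω)) : Prop :=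
  relCap Ω p A = 0

/-- Quasi continuity on `Ω̄` with respect to the relative `p`-capacity. -/
def IsQuasiCont (Ω : Opens (Euc N)) (p : ℝ≥0) [Fact (1 ≤ (p : ℝ≥0∞))] (f : Clos Ω → ℝ) : Prop :=
  ∀ ε : ℝ≥0∞, 0 < ε → ∃ V : Set (Clos Ω), IsOpen V ∧ relCap Ω p V < ε ∧ ContinuousOn f Vᶜ

/-- Equality outside a polar set. -/
def QEq (Ω : Opens (Euc N)) (p : ℝ≥0) [Fact (1 ≤ (p : ℝ≥0∞))] (f g : Clos Ω → ℝ) : Prop :=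
  ∃ P : Set (Clos Ω), IsPolar Ω p P ∧ ∀ x ∉ P, f x = g x

/-- The refined Sobolev space `𝒲^{1,p}(Ω) = {ũ : u ∈ W̃^{1,p}(Ω)}` with the norm of `W^{1,p}(Ω)`.
The element `ũ` is indexed by `u`; the pointwise defined functions on `Ω̄` which it consists of
are `Refined.cls`. -/
def Refined (Ω : Opens (Euc N)) (p : ℝ≥0) [Fact (1 ≤ (p : ℝ≥0∞))] : Type :=
  sobolevTilde Ω p

instance (Ω : Opens (Euc N)) (p : ℝ≥0) [Fact (1 ≤ (p : ℝ≥0∞))] :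
    NormedAddCommGroup (Refined Ω p) :=
  inferInstanceAs (NormedAddCommGroup (sobolevTilde Ω p))

instance (Ω : Opens (Euc N)) (p : ℝ≥0) [Fact (1 ≤ (p : ℝ≥0∞))] :
    NormedSpace ℝ (Refined Ω p) :=
  inferInstanceAs (NormedSpace ℝ (sobolevTilde Ω p))

/-- The Sobolev function `u` underlying `ũ`. -/
def Refined.base (u : Refined Ω p) : Sobolev Ω p := Subtype.val (p := (· ∈ sobolevTilde Ω p)) u

/-- The class `ũ` of functions on `Ω̄`: all quasi continuous functions which are quasi everywhere
equal to a quasi continuous version of `u`. -/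
def Refined.cls (u : Refined Ω p) : Set (Clos Ω → ℝ) :=
  {f | IsQuasiCont Ω p f ∧ ∃ g, IsQuasiCont Ω p g ∧ IsVersion g u.base ∧ QEq Ω p f g}

theorem p_pos : 0 < p := by
  have h : (1 : ℝ≥0∞) ≤ (p : ℝ≥0∞) := Fact.out
  have h' : (1 : ℝ≥0) ≤ p := by exact_mod_cast h
  exact lt_of_lt_of_le one_pos h'

theorem relCap_empty : relCap Ω p ∅ = 0 := by
  have h : (0 : Sobolev Ω p) ∈ admissible Ω p ∅ :=
    ⟨Submodule.zero_mem _, ∅, isOpen_empty, subset_rfl, by simp⟩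
  have h2 : relCap Ω p ∅ ≤ ‖(0 : Sobolev Ω p)‖ₑ ^ (p : ℝ) := iInf₂_le (0 : Sobolev Ω p) h
  have hp : (0 : ℝ) < p := by exact_mod_cast p_pos (p := p)
  rw [enorm_zero, ENNReal.zero_rpow_of_pos hp] at h2
  exact le_antisymm h2 bot_le

theorem isQuasiCont_of_continuous {f : Clos Ω → ℝ} (hf : Continuous f) : IsQuasiCont Ω p f :=
  fun ε hε => ⟨∅, isOpen_empty, by rwa [relCap_empty], hf.continuousOn⟩

/-- Polar sets are Lebesgue null in `Ω`. -/
theorem IsPolar.ae_notMem {P : Set (Clos Ω)} (hP : IsPolar Ω p P) :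
    ∀ᵐ x ∂(volume.restrict (Ω : Set (Euc N))),
      ∀ hx : x ∈ closure (Ω : Set (Euc N)), (⟨x, hx⟩ : Clos Ω) ∉ P := by
  have hp : (0 : ℝ) < p := by exact_mod_cast p_pos (p := p)
  have hp0 : (p : ℝ≥0∞) ≠ 0 := by exact_mod_cast (p_pos (p := p)).ne'
  rw [ae_iff]
  refine le_antisymm (le_of_forall_gt fun ε hε => ?_) bot_le
  have h1 : relCap Ω p P < ε := by rw [hP]; exact hε
  obtain ⟨u, hu, hlt⟩ := by simpa only [relCap, iInf_lt_iff] using h1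
  obtain ⟨-, O, -, hPO, hO⟩ := hu
  have hle : volume.restrict (Ω : Set (Euc N)) {x | 1 ≤ ‖fn u x‖ₑ} ≤ ‖u‖ₑ ^ (p : ℝ) := by
    have hm : AEStronglyMeasurable (fn u) (volume.restrict (Ω : Set (Euc N))) :=
      (Lp.memLp (u.tuple none)).1
    have h2 := mul_meas_ge_le_pow_eLpNorm' (volume.restrict (Ω : Set (Euc N))) hp0
      ENNReal.coe_ne_top hm 1
    simp only [ENNReal.one_rpow, one_mul, ENNReal.coe_toReal] at h2
    refine h2.trans (ENNReal.rpow_le_rpow ?_ hp.le)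
    have h3 : eLpNorm (fn u) p (volume.restrict (Ω : Set (Euc N)))
        = ‖u.tuple none‖ₑ := (Lp.enorm_def _).symm
    rw [h3, ← ofReal_norm, ← ofReal_norm]
    exact ENNReal.ofReal_le_ofReal (PiLp.norm_apply_le u.tuple none)
  refine lt_of_le_of_lt (le_trans (measure_mono_ae ?_) hle) hlt
  filter_upwards [hO] with x hx hmem
  have hmem' : ¬ ∀ hx : x ∈ closure (Ω : Set (Euc N)), (⟨x, hx⟩ : Clos Ω) ∉ P := hmem
  push Not at hmem'
  obtain ⟨hx', hxP⟩ := hmem'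
  have h4 := hx hx' (hPO hxP)
  change 1 ≤ ‖fn u x‖ₑ
  rw [Real.enorm_eq_ofReal_abs, ← ENNReal.ofReal_one]
  exact ENNReal.ofReal_le_ofReal (h4.trans (le_abs_self _))

theorem Refined.mem_cls_iff_of_continuous {f : Clos Ω → ℝ} (hf : Continuous f)
    (u : Refined Ω p) : f ∈ u.cls ↔ IsVersion f u.base := by
  constructor
  · rintro ⟨-, g, -, hg, P, hP, hfg⟩
    filter_upwards [hg, hP.ae_notMem] with x h1 h2 hx
    rw [hfg _ (h2 hx), h1 hx]
  · intro h
    exact ⟨isQuasiCont_of_continuous hf, f, isQuasiCont_of_continuous hf, h,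
      ∅, relCap_empty, fun _ _ => rfl⟩

/-- `𝒲^{1,p}(Ω) ∩ C_c(Ω̄)`: the pairs of a continuous, compactly supported function `v` on `Ω̄` and
the element of `𝒲^{1,p}(Ω)` to which it belongs. -/
def refinedCc (Ω : Opens (Euc N)) (p : ℝ≥0) [Fact (1 ≤ (p : ℝ≥0∞))] :
    Submodule ℝ (C_c(Clos Ω, ℝ) × Refined Ω p) where
  carrier := {w | ⇑w.1 ∈ w.2.cls}
  zero_mem' := (Refined.mem_cls_iff_of_continuous (map_continuous _) _).2 isVersion_zero
  add_mem' := by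
    intro w w' hw hw'
    have h := (Refined.mem_cls_iff_of_continuous (map_continuous _) _).1 hw
    have h' := (Refined.mem_cls_iff_of_continuous (map_continuous _) _).1 hw'
    exact (Refined.mem_cls_iff_of_continuous (map_continuous _) _).2 (h.add h')
  smul_mem' := by
    intro c w hw
    have h := (Refined.mem_cls_iff_of_continuous (map_continuous _) _).1 hw
    exact (Refined.mem_cls_iff_of_continuous (map_continuous _) _).2 (h.smul c)

/-- `𝒲^{1,p}(Ω) ∩ C_c(Ω̄)` as a vector space. -/
def RefinedCc (Ω : Opens (Euc N)) (p : ℝ≥0) [Fact (1 ≤ (p : ℝ≥0∞))] : Type :=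
  refinedCc Ω p

instance (Ω : Opens (Euc N)) (p : ℝ≥0) [Fact (1 ≤ (p : ℝ≥0∞))] :
    AddCommGroup (RefinedCc Ω p) :=
  inferInstanceAs (AddCommGroup (refinedCc Ω p))

instance (Ω : Opens (Euc N)) (p : ℝ≥0) [Fact (1 ≤ (p : ℝ≥0∞))] :
    Module ℝ (RefinedCc Ω p) :=
  inferInstanceAs (Module ℝ (refinedCc Ω p))

/-- The continuous function underlying an element of `𝒲^{1,p}(Ω) ∩ C_c(Ω̄)`. -/
def RefinedCc.cont (w : RefinedCc Ω p) : C_c(Clos Ω, ℝ) :=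
  (Subtype.val (p := (· ∈ refinedCc Ω p)) w).1

/-- The embedding of `𝒲^{1,p}(Ω) ∩ C_c(Ω̄)` into `𝒲^{1,p}(Ω)`. -/
def inclCc (Ω : Opens (Euc N)) (p : ℝ≥0) [Fact (1 ≤ (p : ℝ≥0∞))] :
    RefinedCc Ω p →ₗ[ℝ] Refined Ω p where
  toFun w := (Subtype.val (p := (· ∈ refinedCc Ω p)) w).2
  map_add' _ _ := rfl
  map_smul' _ _ := rfl

/-- The measure `μ` on `Ω̄` belongs to `𝒲^{1,p}(Ω)'`:
`sup {∫ v dμ : v ∈ 𝒲^{1,p}(Ω) ∩ C_c(Ω̄), ‖v‖ ≤ 1} < ∞`. -/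
def MemDual (p : ℝ≥0) [Fact (1 ≤ (p : ℝ≥0∞))] (μ : Measure (Clos Ω)) : Prop :=
  BddAbove {r : ℝ | ∃ v : RefinedCc Ω p, ‖inclCc Ω p v‖ ≤ 1 ∧ r = ∫ x, v.cont x ∂μ}

/-- The functional `v ↦ ∫ v dμ` on `𝒲^{1,p}(Ω) ∩ C_c(Ω̄)`. -/
def integralCc (p : ℝ≥0) [Fact (1 ≤ (p : ℝ≥0∞))] (μ : Measure (Clos Ω))
    [IsLocallyFiniteMeasure μ] : RefinedCc Ω p →ₗ[ℝ] ℝ where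
  toFun v := ∫ x, v.cont x ∂μ
  map_add' v w := integral_add
    ((map_continuous v.cont).integrable_of_hasCompactSupport v.cont.hasCompactSupport)
    ((map_continuous w.cont).integrable_of_hasCompactSupport w.cont.hasCompactSupport)
  map_smul' c _ := integral_const_mul c _

/-- The functional on `𝒲^{1,p}(Ω)` given by a measure in `𝒲^{1,p}(Ω)'`: the continuous extension
of `v ↦ ∫ v dμ` from `𝒲^{1,p}(Ω) ∩ C_c(Ω̄)` (see `toDual_apply` and `toDual_unique`). -/
def toDual (p : ℝ≥0) [Fact (1 ≤ (p : ℝ≥0∞))] (μ : Measure (Clos Ω))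
    [IsLocallyFiniteMeasure μ] : StrongDual ℝ (Refined Ω p) :=
  (integralCc p μ).extendOfNorm (inclCc Ω p)

/-- The energy `E(μ) = ‖μ‖^{p'}`, where the norm is that of `𝒲^{1,p}(Ω)'` and `1/p + 1/p' = 1`. -/
def energy (p : ℝ≥0) [Fact (1 ≤ (p : ℝ≥0∞))] (μ : Measure (Clos Ω))
    [IsLocallyFiniteMeasure μ] : ℝ≥0 :=
  ‖toDual p μ‖₊ ^ Real.conjExponent (p : ℝ)

theorem denseRange_inclCc : DenseRange (inclCc Ω p) := by
  intro u
  rw [Metric.mem_closure_iff]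
  intro ε hε
  have hu : u.base ∈ closure (sobolevCc Ω p : Set (Sobolev Ω p)) := u.2
  obtain ⟨w, ⟨v, hv⟩, hd⟩ := Metric.mem_closure_iff.1 hu ε hε
  have hw : w ∈ sobolevTilde Ω p := Submodule.le_topologicalClosure _ ⟨v, hv⟩
  refine ⟨⟨w, hw⟩, ⟨⟨(v, ⟨w, hw⟩), ?_⟩, rfl⟩, hd⟩
  exact (Refined.mem_cls_iff_of_continuous (map_continuous v) _).2 hv

theorem MemDual.exists_bound {μ : Measure (Clos Ω)} [IsLocallyFiniteMeasure μ]
    (h : MemDual p μ) : ∃ C, ∀ w, ‖integralCc p μ w‖ ≤ C * ‖inclCc Ω p w‖ := by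
  obtain ⟨M, hM⟩ := h
  have hb : ∀ w : RefinedCc Ω p, ‖inclCc Ω p w‖ ≤ 1 → integralCc p μ w ≤ M :=
    fun w hw => hM ⟨w, hw, rfl⟩
  have hM0 : 0 ≤ M := by simpa using hb 0 (by simp)
  have hpos : ∀ w : RefinedCc Ω p, integralCc p μ w ≤ M * ‖inclCc Ω p w‖ := by
    intro w
    refine le_of_forall_pos_le_add fun ε hε => ?_
    set δ := ε / (M + 1) with hδ
    have hδ0 : 0 < δ := by positivity
    set t := ‖inclCc Ω p w‖ + δ with ht
    have ht0 : 0 < t := by positivity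
    have h1 := hb (t⁻¹ • w) (by
      rw [map_smul, norm_smul, norm_inv, Real.norm_of_nonneg ht0.le, inv_mul_le_iff₀ ht0]
      linarith)
    rw [map_smul, smul_eq_mul, inv_mul_le_iff₀ ht0] at h1
    have h2 : M * δ ≤ ε := by
      rw [hδ, mul_div_assoc', div_le_iff₀ (by positivity)]
      nlinarith
    calc integralCc p μ w ≤ t * M := h1
      _ = M * ‖inclCc Ω p w‖ + M * δ := by rw [ht]; ring
      _ ≤ _ := by linarith
  refine ⟨M, fun w => abs_le'.2 ⟨hpos w, ?_⟩⟩
  simpa only [map_neg, norm_neg] using hpos (-w)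

theorem toDual_apply {μ : Measure (Clos Ω)} [IsLocallyFiniteMeasure μ] (h : MemDual p μ)
    {v : C_c(Clos Ω, ℝ)} {u : Refined Ω p} (hv : ⇑v ∈ u.cls) :
    toDual p μ u = ∫ x, v x ∂μ :=
  LinearMap.extendOfNorm_eq denseRange_inclCc h.exists_bound
    (show RefinedCc Ω p from (⟨(v, u), hv⟩ : refinedCc Ω p))

theorem toDual_unique {μ : Measure (Clos Ω)} [IsLocallyFiniteMeasure μ] (h : MemDual p μ)
    (ψ : StrongDual ℝ (Refined Ω p))
    (hψ : ∀ (v : C_c(Clos Ω, ℝ)) (u : Refined Ω p), ⇑v ∈ u.cls → ψ u = ∫ x, v x ∂μ) :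
    toDual p μ = ψ := by
  obtain ⟨C, hC⟩ := h.exists_bound
  refine LinearMap.extendOfNorm_unique denseRange_inclCc C hC ψ ?_
  ext w
  exact hψ w.cont (inclCc Ω p w) (Subtype.property (p := (· ∈ refinedCc Ω p)) w)

end RelCap

end

/-! Let `u` be admissible with `u ≥ 1` a.e. on `O ∩ Ω`, and let `K ⊆ O` be compact. The core is
`μ(K) ≤ ‖μ‖ ‖u‖`. Inner regularity of `μ` carries this from `K` to `O`, hence to every `A ⊆ O` by
monotonicity of the outer measure; the `p`-th power and the infimum over `u` then give the capacity,
since `E(μ)^(p-1) = ‖μ‖^p`. Measurability of `A` plays no role, so the bound applies to polar sets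
as well.

For the core, the functional must be tested on continuous functions that are at least about 1 on `K`
and have norm about `‖u‖`. Approximate `u` in norm by `vₙ ∈ W^{1,p} ∩ C_c`; these need not be near 1
on `K`, which may even lie in the boundary. The defect is repaired by adding `η F(1 - vₙ)`, where
`η` is a smooth cutoff equal to 1 on `K` and supported in `O`, and `F` is a `C¹` substitute for the
positive part with `t - δ ≤ F t ≤ t⁺`. The test function `F(vₙ) + η F(1 - vₙ)` is nonnegative and at
least `1 - 2δ` on `K`. Its first summand has norm at most `‖vₙ‖` (`IsVersion.exists_comp`), and the
second tends to 0 in norm because `1 - u ≤ 0` on the support of `η` (`tendsto_norm_zero_of_cutoff`).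
Let `n → ∞`, then `δ → 0`.

The analytic input is the chain rule for weak derivatives of continuous functions
(`IsWeakDeriv.comp`), proved by mollification. Because `F` is `C¹`, neither lattice operations on
Sobolev functions nor quasi continuous representatives of `u` are needed. -/

noncomputable section

namespace RelCap

/-! ### Mollification and the chain rule on the whole space. -/

section Mollification

open Filter ContinuousLinearMap Convolution Topology ContDiff

variable {E : Type*} [NormedAddCommGroup E] [InnerProductSpace ℝ E] [FiniteDimensional ℝ E]

/-- A smooth cutoff function for a compact subset of an open set. -/
theorem exists_smooth_cutoff {K U : Set E} (hK : IsCompact K) (hU : IsOpen U) (hKU : K ⊆ U) :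
    ∃ η : E → ℝ, ContDiff ℝ ∞ η ∧ HasCompactSupport η ∧ tsupport η ⊆ U ∧
      (∀ᶠ x in 𝓝ˢ K, η x = 1) ∧ ∀ x, η x ∈ Set.Icc (0 : ℝ) 1 := by
  obtain ⟨L, hL, hKL, hLU⟩ := exists_compact_between hK hU hKU
  obtain ⟨f, h1, h0, hf⟩ := exists_contMDiffMap_one_nhds_of_subset_interior
    (modelWithCornersSelf ℝ E) (n := ⊤) hK.isClosed hKL
  have hs : tsupport f ⊆ L :=
    closure_minimal (fun x hx => by_contra fun h => hx (h0 x h)) hL.isClosed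
  exact ⟨f, f.contMDiff.contDiff, hL.of_isClosed_subset (isClosed_tsupport _) hs, hs.trans hLU,
    h1, hf⟩

/-- A sequence of bump functions whose supports shrink to the origin. -/
theorem exists_contDiffBump_tendsto {E : Type*} [NormedAddCommGroup E] :
    ∃ ρ : ℕ → ContDiffBump (0 : E), Tendsto (fun n => (ρ n).rOut) atTop (𝓝 0) := by
  refine ⟨fun n => ⟨1 / (n + 1), 2 * (1 / (n + 1)), by positivity, ?_⟩, ?_⟩
  · have : (0 : ℝ) < 1 / (n + 1) := by positivity
    linarith
  · simpa using (tendsto_one_div_add_atTop_nhds_zero_nat (𝕜 := ℝ)).const_mul 2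

variable [MeasurableSpace E] [BorelSpace E]

/-- The convolution of a bounded continuous function with a normalized bump function is bounded,
uniformly in the bump function. -/
theorem abs_normed_convolution_le (ρ : ContDiffBump (0 : E)) {u : E → ℝ} (hu : Continuous u)
    {C : ℝ} (hC : ∀ x, |u x| ≤ C) (x : E) :
    |(ρ.normed volume ⋆[lsmul ℝ ℝ, volume] u) x| ≤ 3 * C := by
  -- The oscillation of `u` is at most `2C`, so the average differs from `u x` by at most `2C`;
  -- adding `|u x| ≤ C` gives `3C`.
  have h := ρ.dist_normed_convolution_le (μ := volume) (x₀ := x) (ε := 2 * C)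
    hu.aestronglyMeasurable (fun y _ => by
      rw [Real.dist_eq]
      linarith [abs_sub (u y) (u x), hC y, hC x])
  rw [Real.dist_eq] at h
  have := abs_add_le ((ρ.normed volume ⋆[lsmul ℝ ℝ, volume] u) x - u x) (u x)
  rw [sub_add_cancel] at this
  linarith [hC x]

/-- Mollification commutes with weak derivatives. -/
theorem fderiv_normed_convolution {u g : E → ℝ} {e : E} (hu : Continuous u)
    (hw : ∀ φ : E → ℝ, ContDiff ℝ ∞ φ → HasCompactSupport φ →
      ∫ x, u x * fderiv ℝ φ x e = -∫ x, g x * φ x) (ρ : ContDiffBump (0 : E)) (x : E) :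
    fderiv ℝ (ρ.normed volume ⋆[lsmul ℝ ℝ, volume] u) x e
      = ∫ y, g y * ρ.normed volume (x - y) := by
  have hρ : ContDiff ℝ ∞ (ρ.normed (volume : Measure E)) := ρ.contDiff_normed
  have hρ1 : ContDiff ℝ 1 (ρ.normed (volume : Measure E)) := hρ.of_le (by simp)
  have hρc := ρ.hasCompactSupport_normed (μ := (volume : Measure E))
  rw [(hρc.hasFDerivAt_convolution_left (lsmul ℝ ℝ) hρ1 hu.locallyIntegrable x).fderiv]
  have hex : ConvolutionExistsAt (fderiv ℝ (ρ.normed (volume : Measure E))) u x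
      ((lsmul ℝ ℝ).precompL E) volume :=
    (hρc.fderiv (𝕜 := ℝ)).convolutionExists_left _ (hρ1.continuous_fderiv (by simp))
      hu.locallyIntegrable x
  rw [convolution_eq_swap, ContinuousLinearMap.integral_apply hex.integrable_swap]
  -- Test with the reflected translate of the bump; the sign from the reflection cancels the one in
  -- the definition of the weak derivative.
  have h := hw (fun y => ρ.normed volume (x - y)) (hρ.comp (contDiff_const.sub contDiff_id))
    (hρc.comp_homeomorph (Homeomorph.subLeft x))
  have hd : ∀ y, fderiv ℝ (fun y => ρ.normed volume (x - y)) y e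
      = -fderiv ℝ (ρ.normed volume) (x - y) e := by
    intro y
    have h1 : HasFDerivAt (fun y => ρ.normed volume (x - y))
        ((fderiv ℝ (ρ.normed volume) (x - y)).comp (-ContinuousLinearMap.id ℝ E)) y :=
      ((hρ1.differentiable (by simp)) (x - y)).hasFDerivAt.comp y
        ((hasFDerivAt_id y).const_sub x)
    rw [h1.fderiv]
    simp
  simp only [hd, mul_neg, integral_neg, neg_inj] at h
  rw [← h]
  refine integral_congr_ae (.of_forall fun y => ?_)
  simp [ContinuousLinearMap.precompL_apply, mul_comm]

/-- Integration by parts for a function of a mollified function, with the mollification moved to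
the other factor. -/
theorem integral_comp_normed_convolution_mul_fderiv {u g : E → ℝ} {e : E} (hu : Continuous u)
    (hg : Integrable g)
    (hw : ∀ φ : E → ℝ, ContDiff ℝ ∞ φ → HasCompactSupport φ →
      ∫ x, u x * fderiv ℝ φ x e = -∫ x, g x * φ x)
    {F f : ℝ → ℝ} (hF : ∀ t, HasDerivAt F (f t) t) (hf : Continuous f)
    {φ : E → ℝ} (hφ : ContDiff ℝ ∞ φ) (hφc : HasCompactSupport φ) (ρ : ContDiffBump (0 : E)) :
    ∫ x, F ((ρ.normed volume ⋆[lsmul ℝ ℝ, volume] u) x) * fderiv ℝ φ x e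
      = -∫ y, g y * (ρ.normed volume ⋆[lsmul ℝ ℝ, volume]
          fun x => f ((ρ.normed volume ⋆[lsmul ℝ ℝ, volume] u) x) * φ x) y := by
  have hFc : Continuous F := continuous_iff_continuousAt.2 fun t => (hF t).continuousAt
  have hφd : Continuous fun x => fderiv ℝ φ x e :=
    (hφ.continuous_fderiv (by simp)).clm_apply continuous_const
  have hφdc : HasCompactSupport fun x => fderiv ℝ φ x e := hφc.fderiv_apply (𝕜 := ℝ) e
  have hmoll := fderiv_normed_convolution hu hw ρ
  have hvs : ContDiff ℝ 1 (ρ.normed volume ⋆[lsmul ℝ ℝ, volume] u) :=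
    ρ.hasCompactSupport_normed.contDiff_convolution_left _ ρ.contDiff_normed hu.locallyIntegrable
  generalize ρ.normed volume ⋆[lsmul ℝ ℝ, volume] u = v at hvs hmoll ⊢
  have hvc : Continuous v := hvs.continuous
  have hψ : Continuous fun x => f (v x) * φ x := (hf.comp hvc).mul hφ.continuous
  have hψc : HasCompactSupport fun x => f (v x) * φ x := hφc.mul_left
  generalize hψdef : (fun x => f (v x) * φ x) = ψ at hψ hψc ⊢
  have hd : ∀ x, fderiv ℝ (fun x => F (v x)) x e = f (v x) * fderiv ℝ v x e := by
    intro x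
    have h1 := (hF (v x)).comp_hasFDerivAt x
      ((hvs.differentiable (by simp)) x).hasFDerivAt
    rw [show (fun x => F (v x)) = F ∘ v from rfl, h1.fderiv]
    simp
  have hvd : Continuous fun x => fderiv ℝ v x e :=
    (hvs.continuous_fderiv (by simp)).clm_apply continuous_const
  have hibp := integral_mul_fderiv_eq_neg_fderiv_mul_of_integrable (μ := (volume : Measure E))
    (f := fun x => F (v x)) (g := φ) (v := e)
    (by
      simp only [hd]
      exact (((hf.comp hvc).mul hvd).mul hφ.continuous).integrable_of_hasCompactSupport
        hφc.mul_left)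
    (((hFc.comp hvc).mul hφd).integrable_of_hasCompactSupport hφdc.mul_left)
    (((hFc.comp hvc).mul hφ.continuous).integrable_of_hasCompactSupport hφc.mul_left)
    (fun x _ => (hF (v x)).differentiableAt.comp x ((hvs.differentiable (by simp)) x))
    (fun x _ => (hφ.differentiable (by simp)) x)
  rw [hibp, neg_inj]
  -- Fubini moves the bump from `g` to `ψ`; the integrand is an integrable product times a bounded
  -- kernel.
  have hint : Integrable (Function.uncurry fun x y => ψ x * g y * ρ.normed volume (x - y))
      ((volume : Measure E).prod volume) := by
    have hρc : Continuous (ρ.normed (volume : Measure E)) := ρ.continuous_normed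
    obtain ⟨B, hB⟩ :=
      ρ.hasCompactSupport_normed.exists_bound_of_continuous hρc
    have h1 : Integrable (fun q : E × E => ψ q.1 * g q.2) ((volume : Measure E).prod volume) :=
      (hψ.integrable_of_hasCompactSupport hψc).mul_prod hg
    exact h1.mul_bdd (c := B) (hρc.comp (continuous_fst.sub continuous_snd)).aestronglyMeasurable
      (.of_forall fun q => hB _)
  calc ∫ x, fderiv ℝ (fun x => F (v x)) x e * φ x
      = ∫ x, ∫ y, ψ x * g y * ρ.normed volume (x - y) := by
        refine integral_congr_ae (.of_forall fun x => ?_)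
        simp only [hd, ← hψdef]
        rw [hmoll x, mul_right_comm, ← integral_const_mul]
        simp only [mul_assoc]
    _ = ∫ y, ∫ x, ψ x * g y * ρ.normed volume (x - y) := integral_integral_swap hint
    _ = _ := by
        refine integral_congr_ae (.of_forall fun y => ?_)
        simp only [convolution_eq_swap, lsmul_apply, smul_eq_mul]
        rw [← integral_const_mul]
        refine integral_congr_ae (.of_forall fun x => ?_)
        simp only
        rw [← ρ.normed_neg, neg_sub]
        ring

/-- The chain rule for weak derivatives of continuous functions with compact support. -/
theorem integral_comp_mul_fderiv {u g : E → ℝ} {e : E} (hu : Continuous u)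
    (huc : HasCompactSupport u) (hg : Integrable g)
    (hw : ∀ φ : E → ℝ, ContDiff ℝ ∞ φ → HasCompactSupport φ →
      ∫ x, u x * fderiv ℝ φ x e = -∫ x, g x * φ x)
    {F f : ℝ → ℝ} (hF : ∀ t, HasDerivAt F (f t) t) (hf : Continuous f)
    {φ : E → ℝ} (hφ : ContDiff ℝ ∞ φ) (hφc : HasCompactSupport φ) :
    ∫ x, F (u x) * fderiv ℝ φ x e = -∫ x, f (u x) * g x * φ x := by
  have hFc : Continuous F := continuous_iff_continuousAt.2 fun t => (hF t).continuousAt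
  have hφd : Continuous fun x => fderiv ℝ φ x e :=
    (hφ.continuous_fderiv (by simp)).clm_apply continuous_const
  have hφdc : HasCompactSupport fun x => fderiv ℝ φ x e := hφc.fderiv_apply (𝕜 := ℝ) e
  obtain ⟨ρ, hρ⟩ := exists_contDiffBump_tendsto (E := E)
  have hswap n := integral_comp_normed_convolution_mul_fderiv hu hg hw hF hf hφ hφc (ρ n)
  obtain ⟨v, hv⟩ : ∃ v : ℕ → E → ℝ, ∀ n, v n = (ρ n).normed volume ⋆[lsmul ℝ ℝ, volume] u :=
    ⟨_, fun _ => rfl⟩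
  have hvs : ∀ n, ContDiff ℝ 1 (v n) := fun n => by
    rw [hv]
    exact (ρ n).hasCompactSupport_normed.contDiff_convolution_left _ (ρ n).contDiff_normed
      hu.locallyIntegrable
  have hvc : ∀ n, Continuous (v n) := fun n => (hvs n).continuous
  obtain ⟨C, hC⟩ := huc.exists_bound_of_continuous hu
  -- All mollified functions take values in one compact interval, so `F` and `f`, which may be
  -- unbounded on the line, can be bounded uniformly in `n`.
  have hvC : ∀ n x, v n x ∈ Set.Icc (-(3 * C)) (3 * C) := fun n x => by
    rw [hv]
    exact abs_le.1 (abs_normed_convolution_le (ρ n) hu hC x)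
  obtain ⟨MF, hMF⟩ := (isCompact_Icc (a := -(3 * C)) (b := 3 * C)).exists_bound_of_continuousOn
    hFc.continuousOn
  obtain ⟨Mf, hMf⟩ := (isCompact_Icc (a := -(3 * C)) (b := 3 * C)).exists_bound_of_continuousOn
    hf.continuousOn
  -- Convergence is needed jointly in the index and the point: `ψ n` is itself mollified on the
  -- right-hand side, so its values near `y` matter, not just at `y`.
  have hjoint : ∀ x, Tendsto (Function.uncurry v) (atTop ×ˢ 𝓝 x) (𝓝 (u x)) := by
    intro x
    rw [show v = fun n => (ρ n).normed volume ⋆[lsmul ℝ ℝ, volume] u from funext hv]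
    exact ContDiffBump.convolution_tendsto_right (φ := fun q : ℕ × E => ρ q.1) (g := fun _ => u)
      (k := Prod.snd) (x₀ := x) (hρ.comp tendsto_fst)
      (.of_forall fun _ => hu.aestronglyMeasurable) ((hu.tendsto x).comp tendsto_snd) tendsto_snd
  have hpt : ∀ x, Tendsto (fun n => v n x) atTop (𝓝 (u x)) := fun x =>
    (hjoint x).comp (tendsto_id.prodMk tendsto_const_nhds)
  simp only [← hv] at hswap
  obtain ⟨ψ, hψdef⟩ : ∃ ψ : ℕ → E → ℝ, ∀ n, ψ n = fun x => f (v n x) * φ x := ⟨_, fun _ => rfl⟩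
  simp only [← hψdef] at hswap
  have hψ : ∀ n, Continuous (ψ n) := fun n => by
    rw [hψdef]
    exact (hf.comp (hvc n)).mul hφ.continuous
  obtain ⟨Cφ, hCφ⟩ := hφc.exists_bound_of_continuous hφ.continuous
  have hMf0 : 0 ≤ Mf := (norm_nonneg _).trans (hMf _ (hvC 0 0))
  have hψb : ∀ n x, |ψ n x| ≤ Mf * Cφ := fun n x => by
    rw [hψdef, abs_mul]
    exact mul_le_mul (hMf _ (hvC n x)) (hCφ x) (abs_nonneg _) hMf0
  have hleft : Tendsto (fun n => ∫ x, F (v n x) * fderiv ℝ φ x e) atTop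
      (𝓝 (∫ x, F (u x) * fderiv ℝ φ x e)) := by
    refine tendsto_integral_of_dominated_convergence (fun x => MF * |fderiv ℝ φ x e|)
      (fun n => ((hFc.comp (hvc n)).mul hφd).aestronglyMeasurable)
      ((hφd.integrable_of_hasCompactSupport hφdc).abs.const_mul MF) (fun n => ?_) ?_
    · refine .of_forall fun x => ?_
      rw [norm_mul]
      exact mul_le_mul_of_nonneg_right (hMF _ (hvC n x)) (norm_nonneg _)
    · exact .of_forall fun x => ((hFc.tendsto _).comp (hpt x)).mul_const _
  have hright : Tendsto (fun n => ∫ y, g y * ((ρ n).normed volume ⋆[lsmul ℝ ℝ, volume] ψ n) y)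
      atTop (𝓝 (∫ y, g y * (f (u y) * φ y))) := by
    -- Since the second mollification falls on `ψ n` and not on `g`, a multiple of `|g|` dominates
    -- and no convergence of mollifications of `g` is required.
    refine tendsto_integral_of_dominated_convergence (fun y => |g y| * (3 * (Mf * Cφ)))
      (fun n => hg.aestronglyMeasurable.mul ?_) (hg.abs.mul_const _) (fun n => ?_) ?_
    · exact ((ρ n).hasCompactSupport_normed.continuous_convolution_left _
        (ρ n).continuous_normed (hψ n).locallyIntegrable).aestronglyMeasurable
    · refine .of_forall fun y => ?_
      rw [norm_mul]
      exact mul_le_mul_of_nonneg_left (abs_normed_convolution_le (ρ n) (hψ n) (hψb n) y)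
        (norm_nonneg _)
    · refine .of_forall fun y => Tendsto.const_mul _ ?_
      refine ContDiffBump.convolution_tendsto_right hρ
        (.of_forall fun n => (hψ n).aestronglyMeasurable) ?_ tendsto_const_nhds
      rw [show ψ = fun n x => f (v n x) * φ x from funext hψdef]
      exact ((hf.tendsto _).comp (hjoint y)).mul ((hφ.continuous.tendsto y).comp tendsto_snd)
  have h := tendsto_nhds_unique hleft (hright.neg.congr fun n => (hswap n).symm)
  rw [h]
  congr 1
  exact integral_congr_ae (.of_forall fun y => by ring)

end Mollification

/-! ### Leibniz and chain rules on `Ω`, by localization. -/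

section WeakDerivatives

open Filter Topology ContDiff

variable {N : ℕ} {Ω : Opens (Euc N)} {i : Fin N} {u g : Euc N → ℝ}

theorem IsWeakDeriv.congr_ae {u' g' : Euc N → ℝ} (h : IsWeakDeriv Ω i u g)
    (hu : u =ᵐ[volume.restrict (Ω : Set (Euc N))] u')
    (hg : g =ᵐ[volume.restrict (Ω : Set (Euc N))] g') : IsWeakDeriv Ω i u' g' := by
  intro φ
  have h1 : ∫ x in Ω, u' x * fderiv ℝ φ x (EuclideanSpace.single i 1)
      = ∫ x in Ω, u x * fderiv ℝ φ x (EuclideanSpace.single i 1) :=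
    integral_congr_ae (by filter_upwards [hu] with x hx; rw [hx])
  have h2 : ∫ x in Ω, g' x * φ x = ∫ x in Ω, g x * φ x :=
    integral_congr_ae (by filter_upwards [hg] with x hx; rw [hx])
  rw [h1, h2, h φ]

/-- The Leibniz rule with a smooth factor, tested against a function which need not vanish near the
boundary of `Ω`. -/
theorem IsWeakDeriv.integral_smooth_mul (h : IsWeakDeriv Ω i u g)
    (hu : LocallyIntegrable u (volume.restrict (Ω : Set (Euc N))))
    (hg : LocallyIntegrable g (volume.restrict (Ω : Set (Euc N))))
    {χ φ : Euc N → ℝ} (hχ : ContDiff ℝ ∞ χ) (hφ : ContDiff ℝ ∞ φ) (hφc : HasCompactSupport φ)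
    (hs : tsupport (fun x => χ x * φ x) ⊆ Ω) :
    ∫ x in Ω, χ x * u x * fderiv ℝ φ x (EuclideanSpace.single i 1)
      = -∫ x in Ω, (χ x * g x + fderiv ℝ χ x (EuclideanSpace.single i 1) * u x) * φ x := by
  set e : Euc N := EuclideanSpace.single i 1 with he
  have hφd : Continuous fun x => fderiv ℝ φ x e :=
    (hφ.continuous_fderiv (by simp)).clm_apply continuous_const
  have hχd : Continuous fun x => fderiv ℝ χ x e :=
    (hχ.continuous_fderiv (by simp)).clm_apply continuous_const
  have hφdc : HasCompactSupport fun x => fderiv ℝ φ x e := hφc.fderiv_apply (𝕜 := ℝ) e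
  -- The product `χ φ` is an admissible test function; the term with the derivative of `χ` moves to
  -- the right.
  have key := h ⟨fun x => χ x * φ x, hχ.mul hφ, hφc.mul_left, hs⟩
  have hd : ∀ x, fderiv ℝ (fun x => χ x * φ x) x e
      = χ x * fderiv ℝ φ x e + φ x * fderiv ℝ χ x e := fun x => by
    rw [fderiv_fun_mul (hχ.differentiable (by simp) x) (hφ.differentiable (by simp) x)]
    simp
  have i1 : Integrable (fun x => u x * (χ x * fderiv ℝ φ x e)) (volume.restrict Ω) :=
    hu.integrable_smul_right_of_hasCompactSupport (hχ.continuous.mul hφd) hφdc.mul_left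
  have i2 : Integrable (fun x => u x * (φ x * fderiv ℝ χ x e)) (volume.restrict Ω) :=
    hu.integrable_smul_right_of_hasCompactSupport (hφ.continuous.mul hχd) hφc.mul_right
  have i3 : Integrable (fun x => g x * (χ x * φ x)) (volume.restrict Ω) :=
    hg.integrable_smul_right_of_hasCompactSupport (hχ.continuous.mul hφ.continuous) hφc.mul_left
  have e1 : ∫ x in Ω, χ x * u x * fderiv ℝ φ x e = ∫ x in Ω, u x * (χ x * fderiv ℝ φ x e) :=
    integral_congr_ae (.of_forall fun x => by ring)
  have e2 : ∫ x in Ω, (χ x * g x + fderiv ℝ χ x e * u x) * φ x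
      = (∫ x in Ω, g x * (χ x * φ x)) + ∫ x in Ω, u x * (φ x * fderiv ℝ χ x e) := by
    rw [← integral_add i3 i2]
    exact integral_congr_ae (.of_forall fun x => by ring)
  simp only [TestFunction.coe_mk, ← he, hd, mul_add] at key
  rw [integral_add i1 i2] at key
  rw [e1, e2]
  linarith

/-- The Leibniz rule with a smooth factor. -/
theorem IsWeakDeriv.smooth_mul (h : IsWeakDeriv Ω i u g)
    (hu : LocallyIntegrable u (volume.restrict (Ω : Set (Euc N))))
    (hg : LocallyIntegrable g (volume.restrict (Ω : Set (Euc N))))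
    {χ : Euc N → ℝ} (hχ : ContDiff ℝ ∞ χ) :
    IsWeakDeriv Ω i (fun x => χ x * u x)
      (fun x => χ x * g x + fderiv ℝ χ x (EuclideanSpace.single i 1) * u x) := fun φ =>
  h.integral_smooth_mul hu hg hχ φ.contDiff φ.hasCompactSupport
    ((tsupport_mul_subset_right (f := χ)).trans φ.tsupport_subset)

/-- The chain rule for weak derivatives of continuous functions. -/
theorem IsWeakDeriv.comp (h : IsWeakDeriv Ω i u g) (hc : ContinuousOn u Ω)
    (hu : LocallyIntegrable u (volume.restrict (Ω : Set (Euc N))))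
    (hg : LocallyIntegrable g (volume.restrict (Ω : Set (Euc N))))
    {F f : ℝ → ℝ} (hF : ∀ t, HasDerivAt F (f t) t) (hf : Continuous f) :
    IsWeakDeriv Ω i (fun x => F (u x)) (fun x => f (u x) * g x) := by
  intro φ
  set e : Euc N := EuclideanSpace.single i 1 with he
  -- With `χ = 1` near the support of `φ`, the function `χ u` is continuous with compact support on
  -- the whole space and agrees with `u` wherever `φ` sees it, so the global chain rule applies to
  -- it.
  obtain ⟨χ, hχ, hχc, hχΩ, hχ1, -⟩ :=
    exists_smooth_cutoff φ.hasCompactSupport Ω.isOpen φ.tsupport_subset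
  have hχd : Continuous fun x => fderiv ℝ χ x e :=
    (hχ.continuous_fderiv (by simp)).clm_apply continuous_const
  have hχdc : HasCompactSupport fun x => fderiv ℝ χ x e := hχc.fderiv_apply (𝕜 := ℝ) e
  have hχ0 : ∀ x ∉ (Ω : Set (Euc N)), χ x = 0 := fun x hx =>
    image_eq_zero_of_notMem_tsupport fun h' => hx (hχΩ h')
  have hχd0 : ∀ x ∉ (Ω : Set (Euc N)), fderiv ℝ χ x e = 0 := fun x hx => by
    rw [image_eq_zero_of_notMem_tsupport (f := fderiv ℝ χ)
      fun h' => hx (hχΩ (tsupport_fderiv_subset ℝ h'))]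
    rfl
  have hcont : Continuous fun x => χ x * u x := by
    refine continuous_of_tsupport fun x hx => ?_
    have hxΩ : x ∈ Ω := hχΩ (tsupport_mul_subset_left hx)
    exact hχ.continuous.continuousAt.mul (hc.continuousAt (Ω.isOpen.mem_nhds hxΩ))
  have hint : Integrable (fun x => χ x * g x + fderiv ℝ χ x e * u x) := by
    have h1 : IntegrableOn (fun x => χ x * g x + fderiv ℝ χ x e * u x) Ω :=
      (hg.integrable_smul_left_of_hasCompactSupport hχ.continuous hχc).add
        (hu.integrable_smul_left_of_hasCompactSupport hχd hχdc)
    refine (integrableOn_iff_integrable_of_support_subset fun x hx => ?_).1 h1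
    by_contra hxΩ
    exact hx (by simp [hχ0 x hxΩ, hχd0 x hxΩ])
  -- Here `ψ` need not be supported in `Ω`; only `χ ψ` is.
  have hweak : ∀ ψ : Euc N → ℝ, ContDiff ℝ ∞ ψ → HasCompactSupport ψ →
      ∫ x, χ x * u x * fderiv ℝ ψ x e
        = -∫ x, (χ x * g x + fderiv ℝ χ x e * u x) * ψ x := by
    intro ψ hψ hψc
    have h1 := h.integral_smooth_mul hu hg hχ hψ hψc
      ((tsupport_mul_subset_left (g := ψ)).trans hχΩ)
    rw [← he] at h1
    rwa [setIntegral_eq_integral_of_forall_compl_eq_zero fun x hx => by simp [hχ0 x hx],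
      setIntegral_eq_integral_of_forall_compl_eq_zero fun x hx => by
        simp [hχ0 x hx, hχd0 x hx]] at h1
  have key := integral_comp_mul_fderiv hcont hχc.mul_right hint hweak hF hf φ.contDiff
    φ.hasCompactSupport
  have hφ0 : ∀ x ∉ tsupport φ, φ x = 0 := fun x hx => image_eq_zero_of_notMem_tsupport hx
  have hφd0 : ∀ x ∉ tsupport φ, fderiv ℝ φ x e = 0 := fun x hx => by
    rw [image_eq_zero_of_notMem_tsupport (f := fderiv ℝ φ)
      fun h' => hx (tsupport_fderiv_subset ℝ h')]
    rfl
  have hev : ∀ x ∈ tsupport φ, χ =ᶠ[𝓝 x] fun _ => 1 := fun x hx =>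
    eventually_nhdsSet_iff_forall.1 hχ1 x hx
  rw [setIntegral_eq_integral_of_forall_compl_eq_zero fun x hx => by
      rw [hφd0 x fun h' => hx (φ.tsupport_subset h'), mul_zero],
    setIntegral_eq_integral_of_forall_compl_eq_zero fun x hx => by
      rw [hφ0 x fun h' => hx (φ.tsupport_subset h'), mul_zero]]
  convert! key using 2
  · ext x
    by_cases hx : x ∈ tsupport φ
    · rw [(hev x hx).eq_of_nhds, one_mul]
    · rw [hφd0 x hx, mul_zero, mul_zero]
  · refine integral_congr_ae (.of_forall fun x => ?_)
    by_cases hx : x ∈ tsupport φ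
    · simp [(hev x hx).eq_of_nhds, (hev x hx).fderiv_eq]
    · simp [hφ0 x hx]

end WeakDerivatives

/-! ### The `C¹` positive part, and new Sobolev functions from functions in `C_c(Ω̄)`. -/

section Construction

open Filter Topology ContDiff

/-- A `C¹` approximation of the positive part. -/
theorem exists_smooth_posPart {δ : ℝ} (hδ : 0 < δ) :
    ∃ F f : ℝ → ℝ, (∀ t, HasDerivAt F (f t) t) ∧ Continuous f ∧ (∀ t, |f t| ≤ 1) ∧
      (∀ t ≤ 0, f t = 0) ∧ (∀ t, 0 ≤ F t) ∧ (∀ t, F t ≤ max t 0) ∧ ∀ t, t - δ ≤ F t := by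
  -- `f` is the ramp from 0 at `t = 0` to 1 at `t = δ`, and `F` is its primitive vanishing at 0;
  -- replacing the jump of the Heaviside function by a ramp costs at most `δ`.
  set f : ℝ → ℝ := fun t => max 0 (min 1 (t / δ)) with hfdef
  have hf : Continuous f := by fun_prop
  have hf0 : ∀ t, 0 ≤ f t := fun t => le_max_left _ _
  have hf1 : ∀ t, f t ≤ 1 := fun t => max_le zero_le_one (min_le_left _ _)
  have hfneg : ∀ t ≤ 0, f t = 0 := fun t ht =>
    max_eq_left ((min_le_right _ _).trans (div_nonpos_of_nonpos_of_nonneg ht hδ.le))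
  have hfδ : ∀ t, δ ≤ t → f t = 1 := fun t ht => by
    have : 1 ≤ t / δ := (one_le_div hδ).2 ht
    simp [hfdef, min_eq_left this]
  have hint : ∀ a b, IntervalIntegrable f volume a b := fun a b => hf.intervalIntegrable a b
  have hFneg : ∀ t ≤ 0, ∫ s in (0 : ℝ)..t, f s = 0 := fun t ht => by
    rw [intervalIntegral.integral_congr (g := fun _ => (0 : ℝ)), intervalIntegral.integral_zero]
    intro s hs
    rw [Set.uIcc_of_ge ht] at hs
    exact hfneg s hs.2
  have hF0 : ∀ t, 0 ≤ ∫ s in (0 : ℝ)..t, f s := fun t => by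
    rcases le_total t 0 with ht | ht
    · rw [hFneg t ht]
    · exact intervalIntegral.integral_nonneg ht fun s _ => hf0 s
  refine ⟨fun t => ∫ s in (0 : ℝ)..t, f s, f, fun t => ?_, hf, fun t => ?_, hfneg, hF0,
    fun t => ?_, fun t => ?_⟩
  · exact intervalIntegral.integral_hasDerivAt_right (hint 0 t)
      (hf.stronglyMeasurableAtFilter _ _) hf.continuousAt
  · rw [abs_of_nonneg (hf0 t)]
    exact hf1 t
  · rcases le_total t 0 with ht | ht
    · simp only [hFneg t ht]
      exact le_max_right _ _
    · refine le_max_of_le_left ?_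
      have := intervalIntegral.integral_mono_on ht (hint 0 t)
        (intervalIntegrable_const (c := (1 : ℝ))) fun s _ => hf1 s
      simpa using this
  · rcases le_total t δ with ht | ht
    · exact (sub_nonpos.2 ht).trans (hF0 t)
    · have h1 : ∫ s in δ..t, f s = t - δ := by
        rw [intervalIntegral.integral_congr (g := fun _ => (1 : ℝ))]
        · simp
        · intro s hs
          rw [Set.uIcc_of_le ht] at hs
          exact hfδ s hs.1
      have h2 := intervalIntegral.integral_add_adjacent_intervals (hint 0 δ) (hint δ t)
      have h3 := hF0 δ
      simp only
      linarith

variable {N : ℕ} {Ω : Opens (Euc N)}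

/-- The extension by zero of a function on `Ω̄`. -/
def extendZero (v : Clos Ω → ℝ) : Euc N → ℝ := Function.extend Subtype.val v 0

theorem extendZero_apply (v : Clos Ω → ℝ) {x : Euc N} (hx : x ∈ closure (Ω : Set (Euc N))) :
    extendZero v x = v ⟨x, hx⟩ :=
  Subtype.val_injective.extend_apply v 0 ⟨x, hx⟩

theorem ae_mem_closure :
    ∀ᵐ x ∂(volume.restrict (Ω : Set (Euc N))), x ∈ closure (Ω : Set (Euc N)) := by
  filter_upwards [ae_restrict_mem Ω.isOpen.measurableSet] with x hx using subset_closure hx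

theorem continuousOn_extendZero {v : Clos Ω → ℝ} (hv : Continuous v) :
    ContinuousOn (extendZero v) Ω := by
  have h : ContinuousOn (extendZero v) (closure (Ω : Set (Euc N))) := by
    rw [continuousOn_iff_continuous_domRestrict]
    convert! hv using 1
    ext x
    exact extendZero_apply v x.2
  exact h.mono subset_closure

variable {p : ℝ≥0}

theorem memLp_extendZero (v : C_c(Clos Ω, ℝ)) :
    MemLp (extendZero v) (p : ℝ≥0∞) (volume.restrict (Ω : Set (Euc N))) := by
  obtain ⟨C, hC⟩ := v.hasCompactSupport.exists_bound_of_continuous (map_continuous v)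
  have hK : IsCompact (Subtype.val '' tsupport v : Set (Euc N)) :=
    v.hasCompactSupport.isCompact.image continuous_subtype_val
  have h1 : MemLp ((Subtype.val '' tsupport v : Set (Euc N)).indicator fun _ => C) (p : ℝ≥0∞)
      (volume.restrict (Ω : Set (Euc N))) :=
    memLp_indicator_const _ hK.measurableSet _
      (.inr ((Measure.restrict_apply_le _ _).trans_lt hK.measure_lt_top).ne)
  refine h1.mono ((continuousOn_extendZero (map_continuous v)).aestronglyMeasurable
    Ω.isOpen.measurableSet) ?_
  filter_upwards [ae_mem_closure] with x hx
  rw [extendZero_apply _ hx]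
  by_cases hxs : (⟨x, hx⟩ : Clos Ω) ∈ tsupport v
  · rw [Set.indicator_of_mem (Set.mem_image_of_mem _ hxs)]
    exact (hC _).trans (le_abs_self _)
  · rw [image_eq_zero_of_notMem_tsupport hxs, norm_zero]
    exact norm_nonneg _

variable [hp : Fact (1 ≤ (p : ℝ≥0∞))]

theorem IsVersion.extendZero_ae_eq {v : Clos Ω → ℝ} {u : Sobolev Ω p} (hv : IsVersion v u) :
    extendZero v =ᵐ[volume.restrict (Ω : Set (Euc N))] fn u := by
  filter_upwards [hv, ae_mem_closure] with x hx hxc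
  rw [extendZero_apply v hxc, hx hxc]

/-- A function in `C_c(Ω̄)` whose weak derivatives are in `L^p` is a Sobolev function. -/
theorem exists_sobolev_of_isWeakDeriv (w : C_c(Clos Ω, ℝ)) {g : Fin N → Euc N → ℝ}
    (hg : ∀ i, MemLp (g i) (p : ℝ≥0∞) (volume.restrict (Ω : Set (Euc N))))
    (hw : ∀ i, IsWeakDeriv Ω i (extendZero w) (g i)) :
    ∃ z : Sobolev Ω p, IsVersion w z ∧
      ∀ i, z.tuple (some i) =ᵐ[volume.restrict (Ω : Set (Euc N))] g i := by
  have hm := memLp_extendZero (p := p) w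
  let U : LpTuple Ω p := WithLp.toLp _ fun j => j.elim hm.toLp fun i => (hg i).toLp
  have hU : U ∈ sobolevGraph Ω p := fun i =>
    (hw i).congr_ae hm.coeFn_toLp.symm (hg i).coeFn_toLp.symm
  refine ⟨(⟨U, hU⟩ : sobolevGraph Ω p), ?_, fun i => (hg i).coeFn_toLp⟩
  filter_upwards [hm.coeFn_toLp] with x hx hxc
  rw [← extendZero_apply w hxc, ← hx]
  rfl

/-- The product of a smooth function with a `C¹` function of an element of `W^{1,p} ∩ C_c`. -/
theorem IsVersion.exists_smooth_mul_comp {v : C_c(Clos Ω, ℝ)} {u : Sobolev Ω p}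
    (hv : IsVersion v u) {χ : Euc N → ℝ} (hχ : ContDiff ℝ ∞ χ) (hχ1 : ∀ x, |χ x| ≤ 1)
    {G G' : ℝ → ℝ} (hG : ∀ t, HasDerivAt G (G' t) t) (hG' : Continuous G')
    (hG1 : ∀ t, |G' t| ≤ 1) (w : C_c(Clos Ω, ℝ)) (hw : ∀ x, w x = χ x * G (v x))
    (hd : ∀ i, MemLp (fun x => fderiv ℝ χ x (EuclideanSpace.single i 1) * G (fn u x)) (p : ℝ≥0∞)
      (volume.restrict (Ω : Set (Euc N)))) :
    ∃ z : Sobolev Ω p, IsVersion w z ∧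
      fn z =ᵐ[volume.restrict (Ω : Set (Euc N))] (fun x => χ x * G (fn u x)) ∧
      ∀ i, z.tuple (some i) =ᵐ[volume.restrict (Ω : Set (Euc N))]
        fun x => χ x * (G' (fn u x) * u.tuple (some i) x)
          + fderiv ℝ χ x (EuclideanSpace.single i 1) * G (fn u x) := by
  have hGc : Continuous G := continuous_iff_continuousAt.2 fun t => (hG t).continuousAt
  have hvu := hv.extendZero_ae_eq
  have hul : ∀ j, LocallyIntegrable (u.tuple j) (volume.restrict (Ω : Set (Euc N))) := fun j =>
    (Lp.memLp (u.tuple j)).locallyIntegrable hp.out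
  have hum : AEStronglyMeasurable (fn u) (volume.restrict (Ω : Set (Euc N))) :=
    (Lp.memLp (u.tuple none)).1
  have hc := continuousOn_extendZero (map_continuous v)
  have hvl : LocallyIntegrable (extendZero v) (volume.restrict (Ω : Set (Euc N))) :=
    (memLp_extendZero (p := p) v).locallyIntegrable hp.out
  have hG'm : ∀ i, MemLp (fun x => G' (fn u x) * u.tuple (some i) x) (p : ℝ≥0∞)
      (volume.restrict (Ω : Set (Euc N))) := fun i => by
    refine (Lp.memLp (u.tuple (some i))).mono
      ((hG'.comp_aestronglyMeasurable hum).mul (Lp.memLp _).1) (.of_forall fun x => ?_)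
    rw [norm_mul]
    exact mul_le_of_le_one_left (norm_nonneg _) (hG1 _)
  -- `G` is 1-Lipschitz, so `|G t| ≤ |G 0| + |t|`. Only local integrability follows, as `G 0` may be
  -- nonzero and `Ω` of infinite measure.
  have hGl : LocallyIntegrable (fun x => G (extendZero v x))
      (volume.restrict (Ω : Set (Euc N))) := by
    refine ((locallyIntegrable_const |G 0|).add
        ((memLp_extendZero (p := p) v).norm.locallyIntegrable hp.out)).mono
      ((hGc.comp_continuousOn hc).aestronglyMeasurable Ω.isOpen.measurableSet)
      (.of_forall fun x => ?_)
    have h := Convex.norm_image_sub_le_of_norm_hasDerivWithin_le (s := Set.univ) (C := 1)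
      (fun t _ => (hG t).hasDerivWithinAt) (fun t _ => hG1 t) convex_univ
      (Set.mem_univ 0) (Set.mem_univ (extendZero v x))
    rw [one_mul, sub_zero] at h
    have h' := norm_sub_norm_le (G (extendZero v x)) (G 0)
    refine le_trans ?_ (le_abs_self _)
    simp only [Pi.add_apply, ← Real.norm_eq_abs]
    linarith
  -- As `G ∘ u` alone may fail to be in `L^p`, the term with the derivative of `χ` is covered by the
  -- hypothesis `hd`.
  have hm : ∀ i, MemLp (fun x => χ x * (G' (fn u x) * u.tuple (some i) x)
      + fderiv ℝ χ x (EuclideanSpace.single i 1) * G (fn u x)) (p : ℝ≥0∞)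
      (volume.restrict (Ω : Set (Euc N))) := fun i => by
    refine MemLp.add ((hG'm i).mono
      (hχ.continuous.aestronglyMeasurable.mul (hG'm i).1) (.of_forall fun x => ?_)) (hd i)
    rw [norm_mul]
    exact mul_le_of_le_one_left (norm_nonneg _) (hχ1 x)
  obtain ⟨z, hz, hzd⟩ := exists_sobolev_of_isWeakDeriv w hm fun i => by
    have h1 : IsWeakDeriv Ω i (extendZero v) (u.tuple (some i)) :=
      IsWeakDeriv.congr_ae (u.2 i) hvu.symm .rfl
    have h2 := h1.comp hc hvl (hul _) hG hG'
    have h3 := h2.smooth_mul hGl (by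
      refine ((hG'm i).locallyIntegrable hp.out).congr ?_
      filter_upwards [hvu] with x hx
      rw [hx]) hχ
    refine h3.congr_ae ?_ ?_
    · filter_upwards [ae_mem_closure] with x hx
      rw [extendZero_apply _ hx, extendZero_apply _ hx, hw]
    · filter_upwards [hvu] with x hx
      rw [hx]
  refine ⟨z, hz, ?_, hzd⟩
  filter_upwards [hz.extendZero_ae_eq, hvu, ae_mem_closure] with x h1 h2 h3
  rw [← h1, ← h2, extendZero_apply _ h3, extendZero_apply _ h3, hw]

end Construction

/-! ### Norm estimates and vanishing of the correction term. -/

section Estimates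

open Filter Topology ContDiff

/-- Dominated convergence to zero in `L^p`. -/
theorem tendsto_eLpNorm_zero_of_dominated {α : Type*} [MeasurableSpace α] {ν : Measure α}
    {p : ℝ≥0} (hp : p ≠ 0) {f : ℕ → α → ℝ} {h : α → ℝ} (hf : ∀ n, AEStronglyMeasurable (f n) ν)
    (hh : MemLp h p ν) (hle : ∀ n, ∀ᵐ x ∂ν, |f n x| ≤ |h x|)
    (hlim : ∀ᵐ x ∂ν, Tendsto (fun n => f n x) atTop (𝓝 0)) :
    Tendsto (fun n => eLpNorm (f n) p ν) atTop (𝓝 0) := by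
  have hp0 : (p : ℝ≥0∞) ≠ 0 := by simpa using hp
  have hpr : (0 : ℝ) < p := NNReal.coe_pos.2 (pos_iff_ne_zero.2 hp)
  have key : Tendsto (fun n => ∫⁻ x, ‖f n x‖ₑ ^ (p : ℝ) ∂ν) atTop (𝓝 (∫⁻ _, 0 ∂ν)) := by
    refine tendsto_lintegral_of_dominated_convergence' (fun x => ‖h x‖ₑ ^ (p : ℝ))
      (fun n => (hf n).enorm.pow_const _) (fun n => ?_) ?_ ?_
    · filter_upwards [hle n] with x hx
      rw [Real.enorm_eq_ofReal_abs, Real.enorm_eq_ofReal_abs]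
      exact ENNReal.rpow_le_rpow (ENNReal.ofReal_le_ofReal hx) hpr.le
    · have := (eLpNorm_lt_top_iff_lintegral_rpow_enorm_lt_top hp0 ENNReal.coe_ne_top).1 hh.2
      simpa using this.ne
    · filter_upwards [hlim] with x hx
      have h1 : Tendsto (fun n => ‖f n x‖ₑ) atTop (𝓝 0) := by simpa using hx.enorm
      have h2 := (ENNReal.continuous_rpow_const (y := (p : ℝ))).tendsto 0
      rw [ENNReal.zero_rpow_of_pos hpr] at h2
      exact h2.comp h1
  rw [lintegral_zero] at key
  have h2 := (ENNReal.continuous_rpow_const (y := 1 / (p : ℝ))).tendsto 0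
  rw [ENNReal.zero_rpow_of_pos (by positivity)] at h2
  refine (h2.comp key).congr fun n => ?_
  rw [eLpNorm_eq_lintegral_rpow_enorm_toReal hp0 ENNReal.coe_ne_top]
  rfl

variable {N : ℕ} {Ω : Opens (Euc N)} {p : ℝ≥0} [hp : Fact (1 ≤ (p : ℝ≥0∞))]

/-- The norm is an `ℓ^p` sum of `L^p` norms, hence monotone in each component; this makes
composition with `F` norm-decreasing. -/
theorem norm_le_norm_of_ae_le {u z : Sobolev Ω p}
    (h : ∀ j, ∀ᵐ x ∂(volume.restrict (Ω : Set (Euc N))), |z.tuple j x| ≤ |u.tuple j x|) :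
    ‖z‖ ≤ ‖u‖ := by
  have hpr : (0 : ℝ) < p := by exact_mod_cast p_pos (p := p)
  have hp' : 0 < (p : ℝ≥0∞).toReal := by simpa using hpr
  change ‖z.tuple‖ ≤ ‖u.tuple‖
  rw [PiLp.norm_eq_sum hp', PiLp.norm_eq_sum hp']
  refine Real.rpow_le_rpow (Finset.sum_nonneg fun j _ => by positivity) ?_ (by positivity)
  exact Finset.sum_le_sum fun j _ =>
    Real.rpow_le_rpow (norm_nonneg _) (Lp.norm_le_norm_of_ae_le (h j)) hp'.le

theorem tendsto_norm_zero_of_tuple {z : ℕ → Sobolev Ω p}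
    (h : ∀ j, Tendsto (fun n => eLpNorm ((z n).tuple j) p (volume.restrict (Ω : Set (Euc N))))
      atTop (𝓝 0)) : Tendsto (fun n => ‖z n‖) atTop (𝓝 0) := by
  have h1 : ∀ j, Tendsto (fun n => (z n).tuple j) atTop (𝓝 0) := fun j => by
    rw [tendsto_zero_iff_norm_tendsto_zero]
    simpa [Lp.norm_def, Function.comp_def] using (ENNReal.tendsto_toReal ENNReal.zero_ne_top).comp (h j)
  have h2 : Tendsto (fun n => (z n).tuple) atTop (𝓝 0) :=
    ((PiLp.continuous_toLp (p : ℝ≥0∞) _).tendsto 0).comp (tendsto_pi_nhds.2 h1)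
  rw [← norm_zero (E := LpTuple Ω p)]
  exact h2.norm

theorem tendsto_eLpNorm_tuple_sub {u : ℕ → Sobolev Ω p} {u₀ : Sobolev Ω p}
    (h : Tendsto u atTop (𝓝 u₀)) (j : Option (Fin N)) :
    Tendsto (fun n => eLpNorm (⇑((u n).tuple j) - ⇑(u₀.tuple j)) p
      (volume.restrict (Ω : Set (Euc N)))) atTop (𝓝 0) := by
  have h1 : Tendsto (fun n => (u n).tuple) atTop (𝓝 u₀.tuple) :=
    (continuous_subtype_val (p := (· ∈ sobolevGraph Ω p))).continuousAt.tendsto.comp h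
  exact (Lp.tendsto_Lp_iff_tendsto_eLpNorm' _ _).1
    (((PiLp.continuous_apply (p : ℝ≥0∞) _ j).tendsto _).comp h1)

/-- A function in `W̃^{1,p}(Ω)` is the limit, in norm and almost everywhere, of functions in
`W^{1,p}(Ω) ∩ C_c(Ω̄)`. -/
theorem exists_seq_of_mem_sobolevTilde {u : Sobolev Ω p} (hu : u ∈ sobolevTilde Ω p) :
    ∃ (x : ℕ → Sobolev Ω p) (v : ℕ → C_c(Clos Ω, ℝ)), (∀ n, IsVersion (v n) (x n)) ∧
      Tendsto x atTop (𝓝 u) ∧ ∀ᵐ y ∂(volume.restrict (Ω : Set (Euc N))),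
        Tendsto (fun n => fn (x n) y) atTop (𝓝 (fn u y)) := by
  obtain ⟨x, hx, hlim⟩ := mem_closure_iff_seq_limit.1
    (show u ∈ closure (sobolevCc Ω p : Set (Sobolev Ω p)) from hu)
  choose v hv using hx
  -- `L^p` convergence gives convergence in measure, hence almost everywhere along a subsequence.
  obtain ⟨ns, hns, hae⟩ := (tendstoInMeasure_of_tendsto_eLpNorm
    (by exact_mod_cast (p_pos (p := p)).ne') (fun n => (Lp.memLp ((x n).tuple none)).1)
    (Lp.memLp (u.tuple none)).1 (tendsto_eLpNorm_tuple_sub hlim none)).exists_seq_tendsto_ae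
  exact ⟨x ∘ ns, v ∘ ns, fun n => hv _, hlim.comp hns.tendsto_atTop, hae⟩

/-- For continuous functions membership in a refined class is just being a version, so quasi
continuity disappears from the rest of the argument. -/
theorem integral_le_norm_toDual_mul {μ : Measure (Clos Ω)} [IsLocallyFiniteMeasure μ]
    (hμ : MemDual p μ) {w : C_c(Clos Ω, ℝ)} {z : Sobolev Ω p} (h : IsVersion w z) :
    ∫ x, w x ∂μ ≤ ‖toDual p μ‖ * ‖z‖ := by
  have hz : z ∈ sobolevTilde Ω p := Submodule.le_topologicalClosure _ ⟨w, h⟩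
  let ζ : Refined Ω p := (⟨z, hz⟩ : sobolevTilde Ω p)
  rw [← toDual_apply hμ (u := ζ) ((Refined.mem_cls_iff_of_continuous (map_continuous w) ζ).2 h)]
  exact (le_abs_self _).trans ((toDual p μ).le_opNorm ζ)

/-- If `u ≥ 1` on the part of `Ω` in which the cutoff function `η` lives, then `η F(1 - uₙ)` tends
to zero in `W^{1,p}(Ω)` as `uₙ` tends to `u`. -/
theorem tendsto_norm_zero_of_cutoff {u : Sobolev Ω p} {x z : ℕ → Sobolev Ω p} {η : Euc N → ℝ}
    (hη : ContDiff ℝ ∞ η) (hηc : HasCompactSupport η) (hη1 : ∀ y, |η y| ≤ 1)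
    (hu : ∀ᵐ y ∂(volume.restrict (Ω : Set (Euc N))), y ∈ tsupport η → 1 ≤ fn u y)
    (hx : Tendsto x atTop (𝓝 u))
    (hxae : ∀ᵐ y ∂(volume.restrict (Ω : Set (Euc N))),
      Tendsto (fun n => fn (x n) y) atTop (𝓝 (fn u y)))
    {F f : ℝ → ℝ} (hf : Continuous f) (hf1 : ∀ t, |f t| ≤ 1)
    (hf0 : ∀ t ≤ 0, f t = 0) (hF0 : ∀ t, 0 ≤ F t) (hFle : ∀ t, F t ≤ max t 0)
    (hz : ∀ n, fn (z n) =ᵐ[volume.restrict (Ω : Set (Euc N))]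
      fun y => η y * F (1 - fn (x n) y))
    (hzd : ∀ n i, (z n).tuple (some i) =ᵐ[volume.restrict (Ω : Set (Euc N))]
        fun y => η y * (-f (1 - fn (x n) y) * (x n).tuple (some i) y)
          + fderiv ℝ η y (EuclideanSpace.single i 1) * F (1 - fn (x n) y)) :
    Tendsto (fun n => ‖z n‖) atTop (𝓝 0) := by
  -- If `b ≥ 1`, then `(1 - a)⁺ ≤ (b - a)⁺ ≤ |a - b|`: where `u ≥ 1`, the correction is controlled
  -- by the approximation error.
  have hFu : ∀ a b : ℝ, 1 ≤ b → |F (1 - a)| ≤ |a - b| := fun a b hb => by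
    rw [abs_of_nonneg (hF0 _)]
    refine (hFle _).trans (max_le ?_ (abs_nonneg _))
    linarith [neg_le_abs (a - b)]
  refine tendsto_norm_zero_of_tuple fun j => ?_
  rcases j with _ | i
  · refine tendsto_of_tendsto_of_tendsto_of_le_of_le tendsto_const_nhds
      (tendsto_eLpNorm_tuple_sub hx none) (fun _ => zero_le) fun n => ?_
    refine eLpNorm_mono_ae ?_
    filter_upwards [hz n, hu] with y h1 h2
    change ‖fn (z n) y‖ ≤ ‖fn (x n) y - fn u y‖
    rw [h1, norm_mul]
    by_cases hy : y ∈ tsupport η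
    · exact (mul_le_of_le_one_left (norm_nonneg _) (hη1 y)).trans (hFu _ _ (h2 hy))
    · rw [image_eq_zero_of_notMem_tsupport hy, norm_zero, zero_mul]
      exact norm_nonneg _
  · set e : Euc N := EuclideanSpace.single i 1
    have hηd : Continuous fun y => fderiv ℝ η y e :=
      (hη.continuous_fderiv (by simp)).clm_apply continuous_const
    obtain ⟨M, hM⟩ := (hηc.fderiv_apply (𝕜 := ℝ) e).exists_bound_of_continuous hηd
    have hηd0 : ∀ y ∉ tsupport η, fderiv ℝ η y e = 0 := fun y hy => by
      rw [image_eq_zero_of_notMem_tsupport (f := fderiv ℝ η)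
        fun h' => hy (tsupport_fderiv_subset ℝ h')]
      rfl
    -- In the derivative, `Dᵢxₙ` is split into `Dᵢxₙ - Dᵢu`, small in `L^p`, and `Dᵢu`, which gives
    -- `r n`. The latter tends to 0 by dominated convergence: `f` is continuous and vanishes at `1 -
    -- u ≤ 0`, even where `u = 1`.
    set r : ℕ → Euc N → ℝ := fun n y => η y * f (1 - fn (x n) y) * u.tuple (some i) y with hr
    have hxm : ∀ n, AEStronglyMeasurable (fn (x n)) (volume.restrict (Ω : Set (Euc N))) := fun n =>
      (Lp.memLp ((x n).tuple none)).1
    have hrm : ∀ n, AEStronglyMeasurable (r n) (volume.restrict (Ω : Set (Euc N))) := fun n =>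
      (hη.continuous.aestronglyMeasurable.mul
        (hf.comp_aestronglyMeasurable (aestronglyMeasurable_const.sub (hxm n)))).mul
        (Lp.memLp _).1
    have hrlim : Tendsto (fun n => eLpNorm (r n) p (volume.restrict (Ω : Set (Euc N)))) atTop
        (𝓝 0) := by
      refine tendsto_eLpNorm_zero_of_dominated (p_pos (p := p)).ne' hrm
        (Lp.memLp (u.tuple (some i))) (fun n => .of_forall fun y => ?_) ?_
      · rw [hr, abs_mul, abs_mul]
        exact mul_le_of_le_one_left (abs_nonneg _)
          (mul_le_one₀ (hη1 y) (abs_nonneg _) (hf1 _))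
      · filter_upwards [hxae, hu] with y h1 h2
        by_cases hy : y ∈ tsupport η
        · have h3 := (hf.tendsto _).comp (h1.const_sub 1)
          rw [hf0 (1 - fn u y) (by linarith [h2 hy])] at h3
          simpa using (h3.const_mul (η y)).mul_const (u.tuple (some i) y)
        · simp [hr, image_eq_zero_of_notMem_tsupport hy]
    have hbound : ∀ n, eLpNorm ((z n).tuple (some i)) p (volume.restrict (Ω : Set (Euc N)))
        ≤ eLpNorm (⇑((x n).tuple (some i)) - ⇑(u.tuple (some i))) p
            (volume.restrict (Ω : Set (Euc N)))
          + eLpNorm (r n) p (volume.restrict (Ω : Set (Euc N)))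
          + ENNReal.ofReal M * eLpNorm (⇑((x n).tuple none) - ⇑(u.tuple none)) p
            (volume.restrict (Ω : Set (Euc N))) := by
      intro n
      set a : Euc N → ℝ := fun y =>
        -(η y * f (1 - fn (x n) y)) * ((x n).tuple (some i) y - u.tuple (some i) y) with ha
      set b : Euc N → ℝ := fun y => fderiv ℝ η y e * F (1 - fn (x n) y) with hb
      have ham : AEStronglyMeasurable a (volume.restrict (Ω : Set (Euc N))) :=
        (hη.continuous.aestronglyMeasurable.mul (hf.comp_aestronglyMeasurable
          (aestronglyMeasurable_const.sub (hxm n)))).neg.mul ((Lp.memLp _).1.sub (Lp.memLp _).1)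
      have hsum : (z n).tuple (some i) =ᵐ[volume.restrict (Ω : Set (Euc N))] a - r n + b := by
        filter_upwards [hzd n i] with y hy
        rw [hy]
        simp only [Pi.add_apply, Pi.sub_apply, ha, hb, hr]
        ring
      -- No continuity of `F` is assumed here, so measurability of `b` is read off from the other
      -- terms of the sum.
      have hbm : AEStronglyMeasurable b (volume.restrict (Ω : Set (Euc N))) := by
        refine (((Lp.memLp ((z n).tuple (some i))).1.sub (ham.sub (hrm n)))).congr ?_
        filter_upwards [hsum] with y hy
        simp [hy]
      rw [eLpNorm_congr_ae hsum]
      refine (eLpNorm_add_le (ham.sub (hrm n)) hbm hp.out).trans (add_le_add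
        ((eLpNorm_sub_le ham (hrm n) hp.out).trans (add_le_add (eLpNorm_mono_ae ?_) le_rfl)) ?_)
      · refine .of_forall fun y => ?_
        rw [ha, norm_mul, norm_neg, norm_mul]
        exact mul_le_of_le_one_left (norm_nonneg _)
          (mul_le_one₀ (hη1 y) (norm_nonneg _) (hf1 _))
      · refine eLpNorm_le_mul_eLpNorm_of_ae_le_mul ?_ _
        filter_upwards [hu] with y h2
        change ‖b y‖ ≤ M * ‖fn (x n) y - fn u y‖
        rw [hb, norm_mul]
        by_cases hy : y ∈ tsupport η
        · exact mul_le_mul (hM y) (hFu _ _ (h2 hy)) (norm_nonneg _)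
            ((norm_nonneg _).trans (hM y))
        · rw [hηd0 y hy, norm_zero, zero_mul]
          exact mul_nonneg ((norm_nonneg _).trans (hM y)) (norm_nonneg _)
    refine tendsto_of_tendsto_of_tendsto_of_le_of_le tendsto_const_nhds ?_ (fun _ => zero_le)
      hbound
    have := ((tendsto_eLpNorm_tuple_sub hx (some i)).add hrlim).add
      (ENNReal.Tendsto.const_mul (a := ENNReal.ofReal M) (tendsto_eLpNorm_tuple_sub hx none)
        (.inr ENNReal.ofReal_ne_top))
    simpa using this

end Estimates

/-! ### Test functions, the estimate for compact sets, and passage to arbitrary sets. -/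

section Capacity

open Filter Topology ContDiff

variable {N : ℕ} {Ω : Opens (Euc N)}

/-- The product of a function in `C_c(ℝ^N)` with a continuous function on `Ω̄`. -/
def cutoffMul (η : Euc N → ℝ) (hη : Continuous η) (hηc : HasCompactSupport η)
    (h : C(Clos Ω, ℝ)) : C_c(Clos Ω, ℝ) where
  toFun y := η y * h y
  continuous_toFun := (hη.comp continuous_subtype_val).mul (map_continuous h)
  hasCompactSupport' :=
    HasCompactSupport.mul_right (f := fun y : Clos Ω => η y)
      (hηc.comp_isClosedEmbedding isClosed_closure.isClosedEmbedding_subtypeVal)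

theorem cutoffMul_apply {η : Euc N → ℝ} (hη : Continuous η) (hηc : HasCompactSupport η)
    (h : C(Clos Ω, ℝ)) (y : Clos Ω) : cutoffMul η hη hηc h y = η y * h y := rfl

variable {p : ℝ≥0} [hp : Fact (1 ≤ (p : ℝ≥0∞))]

/-- The main part of the test function: `|F t| ≤ |t|` controls the function and `|f| ≤ 1` its
derivatives. -/
theorem IsVersion.exists_comp {v : C_c(Clos Ω, ℝ)} {u : Sobolev Ω p} (hv : IsVersion v u)
    {F f : ℝ → ℝ} (hF : ∀ t, HasDerivAt F (f t) t) (hf : Continuous f) (hf1 : ∀ t, |f t| ≤ 1)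
    (hF1 : ∀ t, |F t| ≤ |t|) :
    ∃ (w : C_c(Clos Ω, ℝ)) (z : Sobolev Ω p), IsVersion w z ∧ (∀ y, w y = F (v y)) ∧
      ‖z‖ ≤ ‖u‖ := by
  have hFc : Continuous F := continuous_iff_continuousAt.2 fun t => (hF t).continuousAt
  have hF0 : F 0 = 0 := by simpa using hF1 0
  let w : C_c(Clos Ω, ℝ) :=
    { toFun := fun y => F (v y)
      continuous_toFun := hFc.comp (map_continuous v)
      hasCompactSupport' := v.hasCompactSupport.comp_left hF0 }
  obtain ⟨z, hz, hzn, hzd⟩ := hv.exists_smooth_mul_comp (χ := fun _ => 1) contDiff_const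
    (fun _ => by simp) hF hf hf1 w (fun y => (one_mul _).symm) (fun i => by simp)
  refine ⟨w, z, hz, fun _ => rfl, norm_le_norm_of_ae_le fun j => ?_⟩
  rcases j with _ | i
  · filter_upwards [hzn] with y hy
    change |fn z y| ≤ |fn u y|
    rw [hy, one_mul]
    exact hF1 _
  · filter_upwards [hzd i] with y hy
    rw [hy, one_mul, fderiv_fun_const, Pi.zero_apply, zero_apply, zero_mul,
      add_zero, abs_mul]
    exact mul_le_of_le_one_left (abs_nonneg _) (hf1 _)

/-- The correction term. Outside the support of `v` the factor `F(1 - v)` is the constant `F 1`, so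
compact support and integrability come from `η`. -/
theorem IsVersion.exists_cutoff_comp {v : C_c(Clos Ω, ℝ)} {u : Sobolev Ω p} (hv : IsVersion v u)
    {η : Euc N → ℝ} (hη : ContDiff ℝ ∞ η) (hηc : HasCompactSupport η) (hη1 : ∀ y, |η y| ≤ 1)
    {F f : ℝ → ℝ} (hF : ∀ t, HasDerivAt F (f t) t) (hf : Continuous f) (hf1 : ∀ t, |f t| ≤ 1) :
    ∃ (w : C_c(Clos Ω, ℝ)) (z : Sobolev Ω p), IsVersion w z ∧
      (∀ y, w y = η y * F (1 - v y)) ∧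
      fn z =ᵐ[volume.restrict (Ω : Set (Euc N))] (fun y => η y * F (1 - fn u y)) ∧
      ∀ i, z.tuple (some i) =ᵐ[volume.restrict (Ω : Set (Euc N))]
        fun y => η y * (-f (1 - fn u y) * u.tuple (some i) y)
          + fderiv ℝ η y (EuclideanSpace.single i 1) * F (1 - fn u y) := by
  have hFc : Continuous F := continuous_iff_continuousAt.2 fun t => (hF t).continuousAt
  let h : C(Clos Ω, ℝ) := ⟨fun y => F (1 - v y),
    hFc.comp (continuous_const.sub (map_continuous v))⟩
  obtain ⟨z, hz, hzn, hzd⟩ := hv.exists_smooth_mul_comp hη hη1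
    (G := fun t => F (1 - t)) (G' := fun t => -f (1 - t))
    (fun t => by
      simpa [Function.comp_def] using (hF (1 - t)).comp t ((hasDerivAt_id t).const_sub 1))
    (hf.comp (continuous_const.sub continuous_id)).neg (fun t => by rw [abs_neg]; exact hf1 _)
    (cutoffMul η hη.continuous hηc h) (fun y => rfl) (fun i => by
      have hηd : Continuous fun y => fderiv ℝ η y (EuclideanSpace.single i 1) :=
        (hη.continuous_fderiv (by simp)).clm_apply continuous_const
      refine (memLp_congr_ae ?_).1
        (memLp_extendZero (p := p) (cutoffMul _ hηd (hηc.fderiv_apply (𝕜 := ℝ) _) h))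
      filter_upwards [hv, ae_mem_closure] with y hy hyc
      rw [extendZero_apply _ hyc, cutoffMul_apply, ← hy hyc]
      rfl)
  exact ⟨_, z, hz, fun y => rfl, hzn, hzd⟩

/-- Integrate `c · 1_K ≤ w`. The sign of `c` is free, so `1 - 2δ` is allowed to be negative. -/
theorem const_mul_measureReal_le_integral {X : Type*} [TopologicalSpace X] [T2Space X]
    [MeasurableSpace X] [BorelSpace X] {μ : Measure X} [IsFiniteMeasureOnCompacts μ] {K : Set X}
    (hK : IsCompact K) {c : ℝ} (w : C_c(X, ℝ)) (hw0 : ∀ y, 0 ≤ w y) (hw : ∀ y ∈ K, c ≤ w y) :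
    c * μ.real K ≤ ∫ y, w y ∂μ := by
  have h := integral_mono (μ := μ) (f := K.indicator fun _ => c) (g := w)
    ((integrable_indicator_iff hK.measurableSet).2 (integrableOn_const hK.measure_lt_top.ne))
    ((map_continuous w).integrable_of_hasCompactSupport w.hasCompactSupport) (fun y => by
      by_cases hy : y ∈ K
      · simpa [hy] using hw y hy
      · simpa [hy] using hw0 y)
  rwa [integral_indicator_const _ hK.measurableSet, smul_eq_mul, mul_comm] at h

variable {μ : Measure (Clos Ω)} [IsLocallyFiniteMeasure μ]

/-- The capacitary estimate for compact sets. -/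
theorem measureReal_le_norm_toDual_mul (hμ : MemDual p μ) {u : Sobolev Ω p}
    (hu : u ∈ sobolevTilde Ω p) {O K : Set (Clos Ω)} (hO : IsOpen O) (hK : IsCompact K)
    (hKO : K ⊆ O) (huO : ∀ᵐ x ∂(volume.restrict (Ω : Set (Euc N))),
      ∀ hx : x ∈ closure (Ω : Set (Euc N)), (⟨x, hx⟩ : Clos Ω) ∈ O → 1 ≤ fn u x) :
    μ.real K ≤ ‖toDual p μ‖ * ‖u‖ := by
  -- `O` is the trace of an open set `U` of `ℝ^N`, so the cutoff can be built in `ℝ^N` and may be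
  -- nonzero on the boundary of `Ω`.
  obtain ⟨U, hU, rfl⟩ := isOpen_induced_iff.1 hO
  obtain ⟨η, hη, hηc, hηU, hηK, hη01⟩ := exists_smooth_cutoff
    (hK.image continuous_subtype_val) hU (Set.image_subset_iff.2 hKO)
  have hη1 : ∀ y, |η y| ≤ 1 := fun y => abs_le.2 ⟨by linarith [(hη01 y).1], (hη01 y).2⟩
  have hηone : ∀ y ∈ K, η y = 1 := fun y hy =>
    hηK.self_of_nhdsSet _ (Set.mem_image_of_mem _ hy)
  have huη : ∀ᵐ y ∂(volume.restrict (Ω : Set (Euc N))), y ∈ tsupport η → 1 ≤ fn u y := by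
    filter_upwards [huO, ae_mem_closure] with y h1 h2 h3 using h1 h2 (hηU h3)
  obtain ⟨x, v, hv, hx, hxae⟩ := exists_seq_of_mem_sobolevTilde hu
  have key : ∀ δ > 0, (1 - 2 * δ) * μ.real K ≤ ‖toDual p μ‖ * ‖u‖ := by
    intro δ hδ
    obtain ⟨F, f, hF, hf, hf1, hf0, hF0, hFle, hFδ⟩ := exists_smooth_posPart hδ
    have hF1 : ∀ t, |F t| ≤ |t| := fun t => by
      rw [abs_of_nonneg (hF0 t)]
      exact (hFle t).trans (max_le (le_abs_self t) (abs_nonneg t))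
    choose w₁ z₁ hwz₁ hw₁ hz₁ using fun n => (hv n).exists_comp hF hf hf1 hF1
    choose w₂ z₂ hwz₂ hw₂ hz₂ hzd₂ using fun n =>
      (hv n).exists_cutoff_comp hη hηc hη1 hF hf hf1
    have hlim := tendsto_norm_zero_of_cutoff hη hηc hη1 huη hx hxae hf hf1 hf0 hF0 hFle hz₂ hzd₂
    have hn : ∀ n, (1 - 2 * δ) * μ.real K ≤ ‖toDual p μ‖ * (‖x n‖ + ‖z₂ n‖) := fun n => by
      have h1 : (1 - 2 * δ) * μ.real K ≤ ∫ y, (w₁ n + w₂ n) y ∂μ := by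
        refine const_mul_measureReal_le_integral hK _ (fun y => ?_) fun y hy => ?_
        · rw [CompactlySupportedContinuousMap.add_apply, hw₁, hw₂]
          exact add_nonneg (hF0 _) (mul_nonneg (hη01 _).1 (hF0 _))
        · rw [CompactlySupportedContinuousMap.add_apply, hw₁, hw₂, hηone y hy, one_mul]
          -- On `K`, `F(v) + F(1 - v) ≥ (v - δ) + (1 - v - δ)`, whatever the value of `v`.
          linarith [hFδ (v n y), hFδ (1 - v n y)]
      refine h1.trans ((integral_le_norm_toDual_mul hμ ((hwz₁ n).add (hwz₂ n))).trans ?_)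
      exact mul_le_mul_of_nonneg_left ((norm_add_le _ _).trans (add_le_add (hz₁ n) le_rfl))
        (norm_nonneg _)
    have hlim' := (hx.norm.add hlim).const_mul ‖toDual p μ‖
    rw [add_zero] at hlim'
    exact ge_of_tendsto' hlim' hn
  have hlim : Tendsto (fun δ : ℝ => (1 - 2 * δ) * μ.real K) (𝓝[>] 0) (𝓝 (μ.real K)) := by
    have hc : Continuous fun δ : ℝ => (1 - 2 * δ) * μ.real K := by fun_prop
    simpa using (hc.tendsto 0).mono_left nhdsWithin_le_nhds
  exact le_of_tendsto hlim (eventually_mem_nhdsWithin.mono fun δ hδ => key δ hδ)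

/-- A measure in the dual space with norm zero vanishes. -/
theorem eq_zero_of_toDual_eq_zero [μ.InnerRegular] (hμ : MemDual p μ) (h : toDual p μ = 0) :
    μ = 0 := by
  rw [← Measure.measure_univ_eq_zero, MeasurableSet.univ.measure_eq_iSup_isCompact]
  simp only [ENNReal.iSup_eq_zero]
  intro K _ hK
  obtain ⟨η, hη, hηc, -, hηK, hη01⟩ := exists_smooth_cutoff
    (hK.image continuous_subtype_val) isOpen_univ (Set.subset_univ _)
  have hη1 : ∀ y, |η y| ≤ 1 := fun y => abs_le.2 ⟨by linarith [(hη01 y).1], (hη01 y).2⟩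
  -- With `v = 0` and `F = id` the construction yields the cutoff `η` itself.
  obtain ⟨w, z, hwz, hw, -⟩ := (isVersion_zero (Ω := Ω) (p := p)).exists_cutoff_comp (v := 0)
    hη hηc hη1 (F := id) (f := fun _ => 1) hasDerivAt_id continuous_const (fun _ => by simp)
  have hw' : ∀ y, w y = η y := fun y => by simp [hw]
  have h1 : 1 * μ.real K ≤ ∫ y, w y ∂μ :=
    const_mul_measureReal_le_integral hK w (fun y => by rw [hw']; exact (hη01 _).1) fun y hy => by
      rw [hw', hηK.self_of_nhdsSet _ (Set.mem_image_of_mem _ hy)]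
  have h2 := h1.trans (integral_le_norm_toDual_mul hμ hwz)
  rw [h, norm_zero, zero_mul, one_mul] at h2
  exact (measureReal_eq_zero_iff hK.measure_lt_top.ne).1 (le_antisymm h2 measureReal_nonneg)

/-- `p' = p / (p - 1)`, hence `p' (p - 1) = p`. -/
theorem energy_rpow (hp1 : 1 < p) :
    (energy p μ : ℝ≥0∞) ^ ((p : ℝ) - 1) = ‖toDual p μ‖ₑ ^ (p : ℝ) := by
  have h1 : (0 : ℝ) < p - 1 := sub_pos.2 (by exact_mod_cast hp1)
  have h2 : Real.conjExponent (p : ℝ) * ((p : ℝ) - 1) = p := by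
    rw [Real.conjExponent, div_mul_cancel₀ _ h1.ne']
  rw [energy, ← ENNReal.coe_rpow_of_nonneg _ h1.le, ← NNReal.rpow_mul, h2,
    ENNReal.coe_rpow_of_nonneg _ (by positivity)]
  rfl

/-- The capacitary estimate for arbitrary sets. -/
theorem measure_rpow_le_energy_mul_relCap [μ.InnerRegular] (hp1 : 1 < p) (hμ : MemDual p μ)
    (A : Set (Clos Ω)) :
    μ A ^ (p : ℝ) ≤ (energy p μ : ℝ≥0∞) ^ ((p : ℝ) - 1) * relCap Ω p A := by
  have hpr : (0 : ℝ) < p := by exact_mod_cast p_pos (p := p)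
  rw [energy_rpow hp1]
  -- With zero energy and infinite capacity the right-hand side is `0 · ∞ = 0`, so `μ = 0` must be
  -- known separately; otherwise the factor is nonzero and finite and passes through the infimum.
  rcases eq_or_ne (toDual p μ) 0 with h0 | h0
  · have hA : μ A = 0 := by rw [eq_zero_of_toDual_eq_zero hμ h0, Measure.coe_zero, Pi.zero_apply]
    rw [hA, ENNReal.zero_rpow_of_pos hpr]
    exact zero_le
  have hne : ‖toDual p μ‖ₑ ^ (p : ℝ) ≠ 0 := by
    have hpos : 0 < ‖toDual p μ‖ₑ := by
      rw [← ofReal_norm]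
      exact ENNReal.ofReal_pos.2 (norm_pos_iff.2 h0)
    exact (ENNReal.rpow_pos hpos enorm_ne_top).ne'
  have htop : ‖toDual p μ‖ₑ ^ (p : ℝ) ≠ ⊤ := ENNReal.rpow_ne_top_of_nonneg hpr.le enorm_ne_top
  rw [relCap, ENNReal.mul_iInf_of_ne hne htop]
  refine le_iInf fun u => ?_
  rw [ENNReal.mul_iInf_of_ne hne htop]
  refine le_iInf fun hu => ?_
  obtain ⟨hut, O, hO, hAO, huO⟩ := hu
  rw [← ENNReal.mul_rpow_of_nonneg _ _ hpr.le]
  refine ENNReal.rpow_le_rpow ((measure_mono hAO).trans ?_) hpr.le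
  rw [hO.measurableSet.measure_eq_iSup_isCompact]
  refine iSup₂_le fun K hKO => iSup_le fun hK => ?_
  have h := measureReal_le_norm_toDual_mul hμ hut hO hK hKO huO
  rw [← ofReal_norm, ← ofReal_norm, ← ENNReal.ofReal_mul (norm_nonneg _),
    ← ENNReal.ofReal_toReal hK.measure_lt_top.ne]
  exact ENNReal.ofReal_le_ofReal h

end Capacity

end RelCap

end

theorem mainTheorem11 {N : ℕ} (Ω : TopologicalSpace.Opens (EuclideanSpace ℝ (Fin N)))
    (hΩ : (Ω : Set (EuclideanSpace ℝ (Fin N))).Nonempty)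
    (p : NNReal) [Fact (1 ≤ (p : ENNReal))] (hp : 1 < p)
    (μ : MeasureTheory.Measure (closure (Ω : Set (EuclideanSpace ℝ (Fin N)))))
    [MeasureTheory.IsLocallyFiniteMeasure μ] [μ.InnerRegular]
    (hμ : RelCap.MemDual p μ) :
    (∀ A : Set (closure (Ω : Set (EuclideanSpace ℝ (Fin N)))),
      MeasureTheory.NullMeasurableSet A μ →
        μ A ^ (p : ℝ) ≤ (RelCap.energy p μ : ENNReal) ^ ((p : ℝ) - 1) * RelCap.relCap Ω p A) ∧
    (∀ P : Set (closure (Ω : Set (EuclideanSpace ℝ (Fin N)))),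
      RelCap.IsPolar Ω p P → μ P = 0) := by
  exact ⟨fun A _ => RelCap.measure_rpow_le_energy_mul_relCap hp hμ A, fun P hP => by
    have h := RelCap.measure_rpow_le_energy_mul_relCap hp hμ P
    rw [show RelCap.relCap Ω p P = 0 from hP, mul_zero, nonpos_iff_eq_zero,
      ENNReal.rpow_eq_zero_iff_of_pos (by exact_mod_cast RelCap.p_pos (p := p))] at h
    exact h⟩
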